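/- A (simple) point process on $\mathbb{R}$ is a probability measure on the set of locally finite subsets $X\subset\mathbb{R}$ (with the $\sigma$-algebra generated by the counting maps $X\mapsto\#(X\cap B)$, $B$ Borel). It has $k$-point correlation function $\rho_k\ge 0$ if, for all measurable $F:\mathbb{R}^k\to[0,\infty]$, $$\mathbb{E}\sum_{x_1,\dots,x_k\in X\text{ pairwise distinct}}F(x_1,\dots,x_k)=\int_{\mathbb{R}^k}F\rho_k\,dx_1\cdots dx_k .$$ With $s(v)=\frac{\sin \pi v}{\pi v}$, $s(0)=1$, put $K^{(2)}(x,y)=s(x-y)$ and $$K^{(1)}(x,y)=\begin{pmatrix} s(x-y)&\partial_x s(x-y)\\ \frac1\pi\int_0^{\pi(x-y)}\frac{\sin t}{t}dt-\frac12\operatorname{sgn}(x-y)& s(x-y)\end{pmatrix},\qquad K^{(4)}(x,y)=\begin{pmatrix} s(2(x-y))&\partial_x s(2(x-y))\\ \frac1{2\pi}\int_0^{2\pi(x-y)}\frac{\sin t}{t}dt& s(2(x-y))\end{pmatrix}.$$ The $\beta$-sine process is the point process with correlation functions, for all $n\ge1$, $\rho^{(2)}_n(x_1,\dots,x_n)=\det(K^{(2)}(x_i,x_j))_{i,j\le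 n}$ if $\beta=2$ and $\rho^{(\beta)}_n(x_1,\dots,x_n)=\operatorname{qdet}(K^{(\beta)}(x_i,x_j))_{i,j\le n}$ if $\beta=1,4$, where for $2\times2$ matrices $q_{ij}$ $$\operatorname{qdet}(q_{ij})=\sum_{\sigma\in S_n}\operatorname{sgn}(\sigma)\prod_{\text{cycles }a\to b\to\cdots\to d\to a\text{ of }\sigma}\tfrac12\operatorname{tr}(q_{ab}q_{bc}\cdots q_{da}).$$ For $N\in\mathbb{N}$, $N\ge1$, let $$\mathcal{W}_N(X)=-\frac1N\sum_{a\ne b,\ a,b\in X\cap[0,N]}\log\Bigl|2\sin\frac{\pi(a-b)}{N}\Bigr|+\log N .$$ **Proposition.** Let $\beta\in\{1,2,4\}$, consider a $\beta$-sine process, and let $T_2(v)=1-\rho_2^{(\beta)}(v,0)$. Then: (a) $1$ is a one-point correlation function and $1-T_2(x-y)$ a two-point correlation function of the process; $\sup_v|T_2(v)|<\infty$; the improper integral $\int_{-\infty}^\infty T_2(v)\,dv$ (the limit of $\int_a^b$ as $a\to-\infty$, $b\to\infty$ independently) converges to $1$, and the improper integral $\int_{-\infty}^\infty T_2(v)\log|v|\,dv$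 converges; and there are positive numbers $(\alpha_N)_{N\ge1}$ and $\varepsilon>0$ with $\log N=o(\alpha_N)$ and $\alpha_N=o(N^{1/2-\varepsilon})$ such that, as $N\to\infty$, $\int_{\alpha_N}^A T_2(v)\log|2\sin\frac{\pi v}{N}|\,dv=o(1)$ uniformly in $A\in[\alpha_N,N-\alpha_N]$ and $1-\int_{-\alpha_N}^{\alpha_N}T_2(v)\,dv=o((\log N)^{-1})$. (b) $\mathcal{W}_N$ is integrable for every $N\ge1$, and, $\gamma$ being Euler's constant, $$\lim_{N\to\infty}\mathbb{E}\,\mathcal{W}_N=\begin{cases}2-\gamma-\log2,&\beta=1,\\ 1-\gamma,&\beta=2,\\ \tfrac32-\log2-\gamma,&\beta=4.\end{cases}$$ -/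

import Mathlib

open MeasureTheory Filter Topology Set Asymptotics

noncomputable section

/-- A locally finite collection of mutually distinct points of the real line. -/
structure PointConfiguration where
  points : Set ℝ
  finite_inter : ∀ K : Set ℝ, IsCompact K → (points ∩ K).Finite

namespace PointConfiguration

/-- The σ-algebra generated by the counting maps `ω ↦ #(ω ∩ B)`, `B` Borel. -/
instance : MeasurableSpace PointConfiguration :=
  ⨆ (B : Set ℝ) (_ : MeasurableSet B),
    MeasurableSpace.comap (fun ω : PointConfiguration => (ω.points ∩ B).encard) inferInstance

/-- The points of `ω` in the window `[0, N]`. -/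
def window (ω : PointConfiguration) (N : ℕ) : Finset ℝ :=
  (ω.finite_inter (Icc 0 (N : ℝ)) isCompact_Icc).toFinset

/-- The one-dimensional renormalized energy `𝒲_N`; the sum runs over the ordered pairs of distinct
points of the configuration in `[0, N]`. -/
def renormalizedEnergy (N : ℕ) (ω : PointConfiguration) : ℝ :=
  -(1 / (N : ℝ)) * (∑ p ∈ (ω.window N).offDiag,
      Real.log |2 * Real.sin (Real.pi * (p.1 - p.2) / N)|) + Real.log N

end PointConfiguration

/-- `ρ` is the `k`-point correlation function of the point process with law `P`. -/
def IsCorrelationFunction (P : Measure PointConfiguration) (k : ℕ) (ρ : (Fin k → ℝ) → ℝ) : Prop :=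
  AEMeasurable ρ volume ∧ (∀ᵐ x, 0 ≤ ρ x) ∧
  ∀ F : (Fin k → ℝ) → ENNReal, Measurable F →
    ∫⁻ ω, ∑' x : {x : Fin k → ℝ // Function.Injective x ∧ ∀ i, x i ∈ ω.points}, F x ∂P
      = ∫⁻ x, F x * ENNReal.ofReal (ρ x)

/-- The quaternion determinant of an `n × n` matrix whose entries are quaternions in their
representation as `2 × 2` matrices:
`∑ σ, (-1)^(n - number of cycles of σ) * ∏ over the cycles (a → b → ⋯ → d → a) of σ,
(1/2) * tr (q_ab q_bc ⋯ q_da)`.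
Each cycle is listed from its smallest element. -/
def quaternionDet {n : ℕ} (q : Fin n → Fin n → Matrix (Fin 2) (Fin 2) ℝ) : ℝ :=
  ∑ σ : Equiv.Perm (Fin n), ((Equiv.Perm.sign σ : ℤ) : ℝ) *
    ∏ i with (∀ j, σ.SameCycle i j → i ≤ j),
      (1 / 2 : ℝ) * Matrix.trace ((List.range (Function.minimalPeriod σ i)).map
        (fun k => q ((σ ^ k) i) ((σ ^ (k + 1)) i))).prod

/-- The kernel `sin π(x-y) / (π(x-y))`. -/
def sineKernelTwo (x y : ℝ) : ℝ := Real.sinc (Real.pi * (x - y))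

def sineKernelOne (x y : ℝ) : Matrix (Fin 2) (Fin 2) ℝ :=
  !![Real.sinc (Real.pi * (x - y)), deriv (fun t => Real.sinc (Real.pi * (t - y))) x;
     (1 / Real.pi) * (∫ t in (0 : ℝ)..(Real.pi * (x - y)), Real.sin t / t)
        - (1 / 2) * Real.sign (x - y),
     Real.sinc (Real.pi * (x - y))]

def sineKernelFour (x y : ℝ) : Matrix (Fin 2) (Fin 2) ℝ :=
  !![Real.sinc (2 * Real.pi * (x - y)), deriv (fun t => Real.sinc (2 * Real.pi * (t - y))) x;
     (1 / (2 * Real.pi)) * (∫ t in (0 : ℝ)..(2 * Real.pi * (x - y)), Real.sin t / t),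
     Real.sinc (2 * Real.pi * (x - y))]

/-- The correlation functions of the `β`-sine process, `β = 1, 2, 4`. -/
def sineCorrelationOne (n : ℕ) (x : Fin n → ℝ) : ℝ :=
  quaternionDet fun i j => sineKernelOne (x i) (x j)

def sineCorrelationTwo (n : ℕ) (x : Fin n → ℝ) : ℝ :=
  Matrix.det (Matrix.of fun i j => sineKernelTwo (x i) (x j))

def sineCorrelationFour (n : ℕ) (x : Fin n → ℝ) : ℝ :=
  quaternionDet fun i j => sineKernelFour (x i) (x j)

/-- `P` is the law of a point process with the correlation functions `ρ n`, `n ≥ 1`. -/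
def HasCorrelationFunctions (P : Measure PointConfiguration) (ρ : ∀ n : ℕ, (Fin n → ℝ) → ℝ) :
    Prop :=
  IsProbabilityMeasure P ∧ ∀ n : ℕ, 1 ≤ n → IsCorrelationFunction P n (ρ n)

/-- `P` is the law of the `β = 1` sine process. -/
def IsSineProcessOne (P : Measure PointConfiguration) : Prop :=
  HasCorrelationFunctions P sineCorrelationOne

/-- `P` is the law of the `β = 2` sine process. -/
def IsSineProcessTwo (P : Measure PointConfiguration) : Prop :=
  HasCorrelationFunctions P sineCorrelationTwo

/-- `P` is the law of the `β = 4` sine process. -/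
def IsSineProcessFour (P : Measure PointConfiguration) : Prop :=
  HasCorrelationFunctions P sineCorrelationFour

/-- The second cluster function `T₂(v) = 1 - ρ₂(v, 0)` of a process with translation invariant
two-point correlation function `ρ₂`. -/
def clusterFunction (ρ : ∀ n : ℕ, (Fin n → ℝ) → ℝ) (v : ℝ) : ℝ := 1 - ρ 2 ![v, 0]

/-- The (possibly only conditionally convergent) integral of `f` over the line converges to `L`. -/
def HasImproperIntegral (f : ℝ → ℝ) (L : ℝ) : Prop :=
  LocallyIntegrable f ∧
    Tendsto (fun p : ℝ × ℝ => ∫ v in p.1..p.2, f v) (atBot ×ˢ atTop) (𝓝 L)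

/-- The hypotheses under which `lim 𝔼 𝒲_N` exists, is finite, and is given by the integral of
`T(v) log |v|`, for a point process with law `P` and second cluster function `T`. -/
structure EnergyLimitAssumptions (P : Measure PointConfiguration) (T : ℝ → ℝ) : Prop where
  rho_one : IsCorrelationFunction P 1 (fun _ => 1)
  rho_two : IsCorrelationFunction P 2 (fun x => 1 - T (x 0 - x 1))
  bounded : BddAbove (range fun v => |T v|)
  integral_eq_one : HasImproperIntegral T 1
  exists_scale : ∃ α : ℕ → ℝ,
    (∀ N, 1 ≤ N → 0 < α N) ∧
    (fun N : ℕ => Real.log N) =o[atTop] α ∧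
    (∃ ε : ℝ, 0 < ε ∧ α =o[atTop] fun N : ℕ => (N : ℝ) ^ (1 / 2 - ε)) ∧
    (∀ δ : ℝ, 0 < δ → ∀ᶠ N : ℕ in atTop, ∀ A ∈ Icc (α N) (N - α N),
      |(∫ v in (α N)..A, T v * Real.log |2 * Real.sin (Real.pi * v / N)|)| < δ) ∧
    (fun N : ℕ => 1 - ∫ v in (-α N)..(α N), T v) =o[atTop] fun N : ℕ => (Real.log N)⁻¹
  log_integral : ∃ L : ℝ, HasImproperIntegral (fun v => T v * Real.log |v|) L

/-- `𝒲_N` has an expectation for every `N ≥ 1`, and these expectations converge to `w`. -/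
def ExpectedEnergyTendsto (P : Measure PointConfiguration) (w : ℝ) : Prop :=
  (∀ N : ℕ, 1 ≤ N → Integrable (PointConfiguration.renormalizedEnergy N) P) ∧
  Tendsto (fun N : ℕ => ∫ ω, PointConfiguration.renormalizedEnergy N ω ∂P) atTop (𝓝 w)

end

noncomputable section

/-! ### Integrability on the half line -/

/-! By Campbell's formula the expected pair sum is the integral of `log |2 sin (π(x-y)/N)| (1 -
T(x-y))` over the square `[0,N]²`. The constant `1` contributes nothing, because `log |2 sin
(πv/N)|` has mean zero over a period. Since `T` is even, the rest is governed by the primitive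
`G_N(y) = ∫_0^y T(v) log |2 sin (πv/N)| dv` (`logSinPrimitive`): the expected energy is exactly `log
N + (2/N) ∫_0^N G_N` (`integral_renormalizedEnergy`).

`G_N` is almost constant on the window. Put `α = N^(1/4)`. Between `α` and `N - α`, integration by
parts against the bound `∫_0^v T = 1/2 + O(1/v)` shows that `G_N` varies by only `O(log N / α)`
(`abs_integral_mul_log_two_sin_le`). The two edges have length `α`, and a crude bound suffices
there. On `[0, α]` the sine may be replaced by its argument, so `2 G_N(α)` is close to `2 ∫_0^α T
log v + (log 2π - log N) · 2 ∫_0^α T`. As `2 ∫_0^α T = 1 + O(1/α)`, the `log N` cancels, and the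
limit is `L + log 2π` with `L = ∫ T(v) log |v| dv` (`tendsto_log_add_average`). All that is used of
`T` is collected in `IsClusterProfile`.

It remains to find `L`. The three cluster functions are `τ(c|v|)`. For `β = 2`, `τ = sinc²` and `c =
π`. For `β = 1` and `4`, `τ = sinc² - sinc' (Si - a)` with `(a, c) = (π/2, π)` and `(0, 2π)`, where
`Si` is the sine integral. Because `τ = 2 sinc² - (sinc Si)' + a sinc'`, three integrals against
`log` on the half line suffice: that of `sinc²` is `(π/2)(1 - γ - log 2)`
(`integral_sinc_sq_mul_log`), that of `(sinc Si)'` is `-π/2`, and that of `sinc'` is `γ - 1`. The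
first and the last come from writing `1/x²` and `log x / x²` through Laplace transforms of `y` and
`y log y`; Euler's constant enters as a derivative of the Gamma function. The middle one comes from
writing `Si(x)/x` as an average of `sinc (t x)` over `t ∈ [0,1]`. -/

lemma abs_log_le_of_le_one {x : ℝ} (h0 : 0 < x) (h1 : x ≤ 1) :
    |Real.log x| ≤ 2 * x ^ (-(1 / 2) : ℝ) := by
  rw [abs_of_nonpos (Real.log_nonpos h0.le h1), ← Real.log_inv]
  have h := Real.log_le_rpow_div (x := x⁻¹) (by positivity) (show (0 : ℝ) < 1 / 2 by norm_num)
  rw [Real.rpow_neg h0.le, ← Real.inv_rpow h0.le]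
  linarith

lemma abs_log_le_of_one_le {x : ℝ} (h1 : 1 ≤ x) : |Real.log x| ≤ 2 * x ^ (1 / 2 : ℝ) := by
  rw [abs_of_nonneg (Real.log_nonneg h1)]
  have h := Real.log_le_rpow_div (x := x) (by positivity) (show (0 : ℝ) < 1 / 2 by norm_num)
  linarith

/-- The exponents leave room for a logarithm: `|log x|` is at most `2 x^(-1/2)` near `0`, and `|log
x| / x²` at most `2 x^(-3/2)` near infinity. -/
lemma integrableOn_Ioi_of_rpow_bounds {f : ℝ → ℝ} {C : ℝ}
    (hf : AEStronglyMeasurable f (volume.restrict (Ioi 0)))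
    (h0 : ∀ x, 0 < x → x ≤ 1 → |f x| ≤ C * x ^ (-(1 / 2) : ℝ))
    (h1 : ∀ x, 1 < x → |f x| ≤ C * x ^ (-(3 / 2) : ℝ)) : IntegrableOn f (Ioi 0) := by
  rw [← Ioc_union_Ioi_eq_Ioi (zero_le_one (α := ℝ)), integrableOn_union]
  constructor
  · have hi : IntegrableOn (fun x : ℝ => C * x ^ (-(1 / 2) : ℝ)) (Ioc 0 1) := by
      have := (intervalIntegral.intervalIntegrable_rpow' (a := 0) (b := 1)
        (show (-1 : ℝ) < -(1 / 2) by norm_num)).const_mul C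
      rwa [intervalIntegrable_iff_integrableOn_Ioc_of_le zero_le_one] at this
    refine Integrable.mono' hi (hf.mono_measure (Measure.restrict_mono Ioc_subset_Ioi_self le_rfl))
      ((ae_restrict_iff' measurableSet_Ioc).2 (ae_of_all _ fun x hx => h0 x hx.1 hx.2))
  · have hi : IntegrableOn (fun x : ℝ => C * x ^ (-(3 / 2) : ℝ)) (Ioi 1) :=
      (integrableOn_Ioi_rpow_of_lt (by norm_num) one_pos).const_mul C
    refine Integrable.mono' hi (hf.mono_measure
      (Measure.restrict_mono (Ioi_subset_Ioi zero_le_one) le_rfl))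
      ((ae_restrict_iff' measurableSet_Ioi).2 (ae_of_all _ fun x hx => h1 x hx))

/-! ### The derivative of `sinc` and the sine integral -/

namespace Real

lemma analyticAt_sinc (x : ℝ) : AnalyticAt ℝ sinc x := by
  rcases eq_or_ne x 0 with rfl | hx
  · obtain ⟨p, hp⟩ := analyticAt_sin (x := (0 : ℝ))
    rw [sinc_eq_dslope]
    exact ⟨_, hp.has_fpower_series_dslope_fslope⟩
  · refine ((analyticAt_sin (x := x)).div analyticAt_id hx).congr ?_
    filter_upwards [isOpen_ne.mem_nhds hx] with y hy
    simp [sinc_of_ne_zero hy]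

lemma hasDerivAt_sinc (x : ℝ) : HasDerivAt sinc (deriv sinc x) x :=
  (analyticAt_sinc x).differentiableAt.hasDerivAt

lemma continuous_deriv_sinc : Continuous (deriv sinc) :=
  continuous_iff_continuousAt.2 fun x => (analyticAt_sinc x).deriv.continuousAt

lemma mul_sinc (x : ℝ) : x * sinc x = sin x := by
  rcases eq_or_ne x 0 with rfl | hx
  · simp
  · rw [sinc_of_ne_zero hx]; field_simp

/-- Differentiate `x sinc x = sin x`. -/
lemma mul_deriv_sinc (x : ℝ) : x * deriv sinc x = cos x - sinc x := by
  have h := (hasDerivAt_id x).mul (hasDerivAt_sinc x)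
  have h' : HasDerivAt sin (1 * sinc x + x * deriv sinc x) x :=
    h.congr_of_eventuallyEq (Eventually.of_forall fun y => (mul_sinc y).symm)
  have := h'.unique (hasDerivAt_sin x)
  linarith

lemma deriv_sinc_neg (x : ℝ) : deriv sinc (-x) = -deriv sinc x := by
  have h : (fun y => sinc (-y)) = sinc := funext sinc_neg
  have := deriv_comp_neg sinc x
  rw [h] at this
  linarith

lemma abs_sinc_le_inv {x : ℝ} (hx : 0 < x) : |sinc x| ≤ 1 / x := by
  rw [sinc_of_ne_zero hx.ne', abs_div, abs_of_pos hx]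
  gcongr
  exact abs_sin_le_one x

lemma exists_abs_deriv_sinc_le : ∃ C, ∀ x, |deriv sinc x| ≤ C := by
  obtain ⟨C, hC⟩ := (isCompact_Icc (a := (-1 : ℝ)) (b := 1)).exists_bound_of_continuousOn
    continuous_deriv_sinc.continuousOn
  refine ⟨max C 2, fun x => ?_⟩
  by_cases hx : |x| ≤ 1
  · exact (hC x (abs_le.1 hx)).trans (le_max_left _ _)
  · refine le_trans ?_ (le_max_right _ _)
    push Not at hx
    have h := congrArg abs (mul_deriv_sinc x)
    rw [abs_mul] at h
    have h2 : |cos x - sinc x| ≤ 2 := by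
      have := abs_sub (cos x) (sinc x)
      have := abs_cos_le_one x
      have := abs_sinc_le_one x
      linarith
    nlinarith [abs_nonneg (deriv sinc x)]

/-- The sine integral. -/
def sinIntegral (x : ℝ) : ℝ := ∫ t in (0 : ℝ)..x, sinc t

lemma sinIntegral_zero : sinIntegral 0 = 0 := by simp [sinIntegral]

lemma integral_sin_div_eq_sinIntegral (x : ℝ) :
    ∫ t in (0 : ℝ)..x, sin t / t = sinIntegral x := by
  refine intervalIntegral.integral_congr_ae ?_
  have : ∀ᵐ t : ℝ, t ≠ 0 := by simp [ae_iff, measure_singleton]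
  filter_upwards [this] with t ht _
  rw [sinc_of_ne_zero ht]

lemma hasDerivAt_sinIntegral (x : ℝ) : HasDerivAt sinIntegral (sinc x) x :=
  intervalIntegral.integral_hasDerivAt_right (continuous_sinc.intervalIntegrable _ _)
    continuous_sinc.stronglyMeasurable.stronglyMeasurableAtFilter continuous_sinc.continuousAt

lemma continuous_sinIntegral : Continuous sinIntegral :=
  continuous_iff_continuousAt.2 fun x => (hasDerivAt_sinIntegral x).continuousAt

lemma sinIntegral_neg (x : ℝ) : sinIntegral (-x) = -sinIntegral x := by
  have h := intervalIntegral.integral_comp_neg (a := 0) (b := x) sinc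
  simp only [sinc_neg, neg_zero] at h
  rw [sinIntegral, sinIntegral, h, intervalIntegral.integral_symm]

lemma abs_sinIntegral_le {x : ℝ} (hx : 0 ≤ x) : |sinIntegral x| ≤ x := by
  have := intervalIntegral.norm_integral_le_of_norm_le_const (a := 0) (b := x) (C := 1)
    (f := sinc) (fun t _ => abs_sinc_le_one t)
  simpa [abs_of_nonneg hx, sinIntegral] using this

/-! ### Laplace transforms -/

lemma integrableOn_mul_exp_neg_mul {y : ℝ} (hy : 0 < y) {f : ℝ → ℝ} (hf : Continuous f)
    (hb : ∀ x, |f x| ≤ 1) : IntegrableOn (fun x => f x * exp (-(x * y))) (Ioi 0) := by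
  refine Integrable.mono' (exp_neg_integrableOn_Ioi 0 hy) (by fun_prop) ?_
  refine ae_of_all _ fun x => ?_
  rw [norm_mul, norm_of_nonneg (exp_pos _).le, neg_mul, mul_comm y x]
  exact mul_le_of_le_one_left (exp_pos _).le (hb x)

lemma tendsto_mul_exp_neg_mul {y : ℝ} (hy : 0 < y) {f : ℝ → ℝ} {C : ℝ} (hb : ∀ x, |f x| ≤ C) :
    Tendsto (fun x => f x * exp (-(x * y))) atTop (𝓝 0) := by
  have h1 : Tendsto (fun x => exp (-(x * y))) atTop (𝓝 0) :=
    tendsto_exp_neg_atTop_nhds_zero.comp (tendsto_id.atTop_mul_const hy)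
  refine squeeze_zero_norm (fun x => ?_) (by simpa using h1.const_mul C)
  rw [norm_mul, norm_of_nonneg (exp_pos _).le]
  exact mul_le_mul_of_nonneg_right (hb x) (exp_pos _).le

lemma integral_sin_sq_mul_exp_neg {y : ℝ} (hy : 0 < y) :
    ∫ x in Ioi 0, sin x ^ 2 * exp (-(x * y)) = 2 / (y * (y ^ 2 + 4)) := by
  -- The antiderivative comes from `sin² x = (1 - cos 2x) / 2`.
  have hd : ∀ x ∈ Ici (0 : ℝ), HasDerivAt
      (fun x => ((y * cos (2 * x) - 2 * sin (2 * x)) / (2 * (y ^ 2 + 4)) - 1 / (2 * y))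
        * exp (-(x * y))) (sin x ^ 2 * exp (-(x * y))) x := by
    intro x _
    have h2 : HasDerivAt (fun x : ℝ => 2 * x) 2 x := by
      simpa using (hasDerivAt_id x).const_mul 2
    have hxy : HasDerivAt (fun x : ℝ => -(x * y)) (-y) x := by
      simpa using! ((hasDerivAt_id x).mul_const y).neg
    have := ((((h2.cos.const_mul y).sub (h2.sin.const_mul 2)).div_const (2 * (y ^ 2 + 4))).sub_const
      (1 / (2 * y))).mul hxy.exp
    convert! this using 1
    simp only [Pi.sub_apply]
    rw [sin_sq_eq_half_sub]
    field_simp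
    ring
  rw [integral_Ioi_of_hasDerivAt_of_tendsto' (m := 0) hd
    (integrableOn_mul_exp_neg_mul hy (by fun_prop) fun x => ?_)
    (tendsto_mul_exp_neg_mul hy (C := (y + 2) / (2 * (y ^ 2 + 4)) + 1 / (2 * y)) fun x => ?_)]
  · simp; field_simp; ring
  · rw [abs_pow]; exact pow_le_one₀ (abs_nonneg _) (abs_sin_le_one x)
  · refine (abs_sub _ _).trans ?_
    rw [abs_div, abs_of_pos (show 0 < 2 * (y ^ 2 + 4) by positivity),
      abs_of_pos (show 0 < 1 / (2 * y) by positivity)]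
    gcongr
    refine (abs_sub _ _).trans ?_
    rw [abs_mul, abs_mul, abs_of_pos hy, abs_two]
    nlinarith [abs_cos_le_one (2 * x), abs_sin_le_one (2 * x)]

lemma integral_sin_mul_exp_neg {y : ℝ} (hy : 0 < y) :
    ∫ x in Ioi 0, sin x * exp (-(x * y)) = 1 / (1 + y ^ 2) := by
  have hd : ∀ x ∈ Ici (0 : ℝ), HasDerivAt
      (fun x => (-(y * sin x + cos x) / (1 + y ^ 2)) * exp (-(x * y)))
      (sin x * exp (-(x * y))) x := by
    intro x _
    have hxy : HasDerivAt (fun x : ℝ => -(x * y)) (-y) x := by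
      simpa using! ((hasDerivAt_id x).mul_const y).neg
    have := ((((hasDerivAt_sin x).const_mul y).add (hasDerivAt_cos x)).neg.div_const
      (1 + y ^ 2)).mul hxy.exp
    convert! this using 1
    simp only [Pi.neg_apply, Pi.add_apply]
    field_simp
    ring
  rw [integral_Ioi_of_hasDerivAt_of_tendsto' (m := 0) hd
    (integrableOn_mul_exp_neg_mul hy (by fun_prop) abs_sin_le_one)
    (tendsto_mul_exp_neg_mul hy (C := (y + 1) / (1 + y ^ 2)) fun x => ?_)]
  · simp; field_simp
  · rw [abs_div, abs_neg, abs_of_pos (show 0 < 1 + y ^ 2 by positivity)]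
    gcongr
    refine (abs_add_le _ _).trans ?_
    rw [abs_mul, abs_of_pos hy]
    nlinarith [abs_cos_le_one x, abs_sin_le_one x]

/-- Replaces the kernel `1/x²` by exponentials, so that Fubini leads to elementary Laplace
transforms. -/
lemma integral_mul_exp_neg_mul {x : ℝ} (hx : 0 < x) :
    ∫ y in Ioi 0, y * exp (-(x * y)) = 1 / x ^ 2 := by
  have := integral_rpow_mul_exp_neg_mul_Ioi (a := 2) two_pos hx
  norm_num at this
  rw [this]
  simp

lemma integrableOn_mul_exp_neg_mul_self {x : ℝ} (hx : 0 < x) :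
    IntegrableOn (fun y => y * exp (-(x * y))) (Ioi 0) :=
  -- A nonzero Bochner integral certifies integrability.
  .of_integral_ne_zero (by rw [integral_mul_exp_neg_mul hx]; positivity)

/-- This is `Γ'(1)`, by differentiating Euler's integral under the integral sign; the next lemma is
`Γ'(2)` in the same way. -/
lemma integral_log_mul_exp_neg :
    ∫ y in Ioi 0, log y * exp (-y) = -eulerMascheroniConstant := by
  have h1 := Complex.hasDerivAt_GammaIntegral (s := 1) (by simp)
  have h2 : HasDerivAt Complex.GammaIntegral (-eulerMascheroniConstant : ℂ) 1 := by
    refine Complex.hasDerivAt_Gamma_one.congr_of_eventuallyEq ?_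
    have : {s : ℂ | 0 < s.re} ∈ 𝓝 (1 : ℂ) :=
      (isOpen_lt continuous_const Complex.continuous_re).mem_nhds (by simp)
    filter_upwards [this] with a ha using (Complex.Gamma_eq_integral ha).symm
  have h3 := h1.unique h2
  have h4 : ((∫ y in Ioi 0, log y * exp (-y) : ℝ) : ℂ) = ((-eulerMascheroniConstant : ℝ) : ℂ) := by
    rw [← integral_complex_ofReal]
    push_cast
    rw [← h3]
    refine setIntegral_congr_fun measurableSet_Ioi fun t ht => ?_
    simp
  exact_mod_cast h4

lemma integral_mul_log_mul_exp_neg :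
    ∫ y in Ioi 0, y * log y * exp (-y) = 1 - eulerMascheroniConstant := by
  have h1 := Complex.hasDerivAt_GammaIntegral (s := 2) (by simp)
  have h2 : HasDerivAt Complex.GammaIntegral (1 - eulerMascheroniConstant : ℂ) 2 := by
    have h := Complex.hasDerivAt_Gamma_nat 1
    have e1 : ((1 : ℕ) : ℂ) + 1 = 2 := by norm_num
    rw [e1] at h
    have h' : HasDerivAt Complex.Gamma (1 - eulerMascheroniConstant : ℂ) 2 := by
      convert! h using 1
      simp; ring
    refine h'.congr_of_eventuallyEq ?_
    have : {s : ℂ | 0 < s.re} ∈ 𝓝 (2 : ℂ) :=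
      (isOpen_lt continuous_const Complex.continuous_re).mem_nhds (by simp)
    filter_upwards [this] with a ha using (Complex.Gamma_eq_integral ha).symm
  have h3 := h1.unique h2
  have h4 : ((∫ y in Ioi 0, y * log y * exp (-y) : ℝ) : ℂ)
      = ((1 - eulerMascheroniConstant : ℝ) : ℂ) := by
    rw [← integral_complex_ofReal]
    push_cast
    rw [← h3]
    refine setIntegral_congr_fun measurableSet_Ioi fun t ht => ?_
    have : (2 : ℂ) - 1 = 1 := by norm_num
    simp [this, mul_assoc]
  exact_mod_cast h4

lemma abs_mul_log_le {y : ℝ} (hy : 0 < y) : |y * log y| ≤ 1 + y ^ 2 := by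
  rcases le_total y 1 with h | h
  · have := abs_log_mul_self_lt y hy h
    rw [mul_comm]
    nlinarith [sq_nonneg y]
  · rw [abs_of_nonneg (mul_nonneg hy.le (log_nonneg h))]
    nlinarith [log_le_sub_one_of_pos hy]

lemma integrableOn_mul_log_mul_exp_neg_mul {x : ℝ} (hx : 0 < x) :
    IntegrableOn (fun y => y * log y * exp (-(x * y))) (Ioi 0) := by
  have h3 : IntegrableOn (fun y : ℝ => y ^ (2 : ℝ) * exp (-(x * y))) (Ioi 0) := by
    have := integral_rpow_mul_exp_neg_mul_Ioi (a := 3) three_pos hx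
    norm_num at this
    refine .of_integral_ne_zero ?_
    norm_num
    rw [this]
    have : 0 < Gamma 3 := Gamma_pos_of_pos (by norm_num)
    positivity
  have h1 : IntegrableOn (fun y : ℝ => exp (-(x * y))) (Ioi 0) := by
    simpa using exp_neg_integrableOn_Ioi 0 hx
  refine Integrable.mono' (h1.add h3) (by fun_prop) ?_
  refine (ae_restrict_iff' measurableSet_Ioi).2 (ae_of_all _ fun y hy => ?_)
  simp only [Pi.add_apply]
  rw [norm_mul, norm_of_nonneg (exp_pos _).le, norm_eq_abs]
  have := mul_le_mul_of_nonneg_right (abs_mul_log_le hy) (exp_pos (-(x * y))).le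
  rw [rpow_two]
  linarith

lemma integral_mul_log_mul_exp_neg_mul {x : ℝ} (hx : 0 < x) :
    ∫ y in Ioi 0, y * log y * exp (-(x * y))
      = (1 - eulerMascheroniConstant - log x) / x ^ 2 := by
  have h := integral_comp_mul_left_Ioi (fun u => u * log u * exp (-u)) 0 hx
  rw [mul_zero, integral_mul_log_mul_exp_neg] at h
  have e : ∀ y ∈ Ioi (0 : ℝ), x * y * log (x * y) * exp (-(x * y))
      = x * (y * log y * exp (-(x * y))) + x * log x * (y * exp (-(x * y))) := by
    intro y hy
    rw [log_mul hx.ne' (ne_of_gt hy)]; ring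
  rw [setIntegral_congr_fun measurableSet_Ioi e, integral_add
    ((integrableOn_mul_log_mul_exp_neg_mul hx).const_mul _)
    ((integrableOn_mul_exp_neg_mul_self hx).const_mul _), integral_const_mul, integral_const_mul,
    integral_mul_exp_neg_mul hx, smul_eq_mul] at h
  field_simp at h ⊢
  linarith

end Real

namespace Real

/-! ### The integrals of `sinc ^ 2` and `sinc ^ 2 * log` -/

/-- Fubini, with the `x`-integral done first. The weight `w = 1` yields the integral of `sinc²`, and
`w = log` that of `sinc² log`. -/
lemma integral_sin_sq_mul_laplace {w : ℝ → ℝ} (hw : Measurable w)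
    (hi : IntegrableOn (fun y => w y * (2 / (y ^ 2 + 4))) (Ioi 0)) :
    ∫ x in Ioi 0, sin x ^ 2 * ∫ y in Ioi 0, y * w y * exp (-(x * y))
      = ∫ y in Ioi 0, w y * (2 / (y ^ 2 + 4)) := by
  have inner : ∀ y ∈ Ioi (0 : ℝ), ∀ c : ℝ,
      ∫ x in Ioi 0, sin x ^ 2 * (y * c * exp (-(x * y))) = c * (2 / (y ^ 2 + 4)) := by
    intro y hy c
    have hy' : (0 : ℝ) < y := hy
    have : ∀ x, sin x ^ 2 * (y * c * exp (-(x * y)))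
        = y * c * (sin x ^ 2 * exp (-(x * y))) := fun x => by ring
    simp_rw [this]
    rw [integral_const_mul, integral_sin_sq_mul_exp_neg hy]
    field_simp
  have hint : Integrable (Function.uncurry fun x y => sin x ^ 2 * (y * w y * exp (-(x * y))))
      ((volume.restrict (Ioi 0)).prod (volume.restrict (Ioi 0))) := by
    rw [integrable_prod_iff' (by fun_prop)]
    constructor
    · refine (ae_restrict_iff' measurableSet_Ioi).2 (ae_of_all _ fun y hy => ?_)
      have h := (integrableOn_mul_exp_neg_mul hy (f := fun x => sin x ^ 2) (by fun_prop)
        (fun x => by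
          rw [abs_pow]; exact pow_le_one₀ (abs_nonneg _) (abs_sin_le_one x))).const_mul (y * w y)
      refine h.congr (ae_of_all _ fun x => ?_)
      simp only [Function.uncurry]; ring
    · refine hi.norm.congr ?_
      refine (ae_restrict_iff' measurableSet_Ioi).2 (ae_of_all _ fun y hy => ?_)
      have hy' : (0 : ℝ) < y := hy
      have e := inner y hy |w y|
      have : ∀ x, ‖Function.uncurry (fun x y => sin x ^ 2 * (y * w y * exp (-(x * y)))) (x, y)‖
          = sin x ^ 2 * (y * |w y| * exp (-(x * y))) := fun x => by
        simp only [Function.uncurry, norm_mul, norm_eq_abs, abs_exp, abs_of_pos hy', abs_pow,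
          sq_abs]
      simp only [this]
      rw [e, norm_mul, norm_eq_abs, norm_of_nonneg (by positivity)]
  have h := integral_integral_swap hint
  simp_rw [integral_const_mul] at h
  rw [h]
  exact setIntegral_congr_fun measurableSet_Ioi fun y hy => inner y hy (w y)

lemma integrableOn_two_div_sq_add_four :
    IntegrableOn (fun y : ℝ => 2 / (y ^ 2 + 4)) (Ioi 0) := by
  refine (Integrable.mono' (integrable_inv_one_add_sq.const_mul 2) ?_ ?_).integrableOn
  · exact (Continuous.div (by fun_prop) (by fun_prop)
      fun y => by positivity).aestronglyMeasurable
  · refine ae_of_all _ fun y => ?_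
    rw [norm_of_nonneg (by positivity), div_eq_mul_inv]
    gcongr ?_ * ?_⁻¹
    linarith

lemma integrableOn_log_mul_inv_one_add_sq :
    IntegrableOn (fun y : ℝ => log y * (1 + y ^ 2)⁻¹) (Ioi 0) := by
  refine integrableOn_Ioi_of_rpow_bounds (C := 2) (by fun_prop) ?_ ?_
  · intro x h0 h1
    rw [abs_mul, abs_of_pos (show (0 : ℝ) < (1 + x ^ 2)⁻¹ by positivity)]
    refine (mul_le_of_le_one_right (abs_nonneg _) ?_).trans (abs_log_le_of_le_one h0 h1)
    exact inv_le_one_of_one_le₀ (by nlinarith)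
  · intro x h1
    rw [abs_mul, abs_of_pos (show (0 : ℝ) < (1 + x ^ 2)⁻¹ by positivity)]
    have h0 : 0 < x := by linarith
    have e : x ^ (-(3 / 2) : ℝ) = x ^ (1 / 2 : ℝ) * (x ^ 2)⁻¹ := by
      rw [← rpow_natCast x 2, ← rpow_neg h0.le, ← rpow_add h0]; norm_num
    rw [e, ← mul_assoc]
    have := abs_log_le_of_one_le h1.le
    gcongr
    linarith

/-- The inversion `y ↦ 1/y` preserves `dy / (1 + y²)` and changes the sign of the logarithm. -/
lemma integral_log_mul_inv_one_add_sq :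
    ∫ y in Ioi (0 : ℝ), log y * (1 + y ^ 2)⁻¹ = 0 := by
  have h := integral_comp_rpow_Ioi (fun y : ℝ => log y * (1 + y ^ 2)⁻¹)
    (show (-1 : ℝ) ≠ 0 by norm_num)
  have e : ∀ x ∈ Ioi (0 : ℝ), (|(-1 : ℝ)| * x ^ ((-1 : ℝ) - 1)) •
      (log (x ^ (-1 : ℝ)) * (1 + (x ^ (-1 : ℝ)) ^ 2)⁻¹) = -(log x * (1 + x ^ 2)⁻¹) := by
    intro x hx
    have hx' : (0 : ℝ) < x := hx
    have e2 : x ^ ((-1 : ℝ) - 1) = (x ^ 2)⁻¹ := by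
      rw [← rpow_natCast x 2, ← rpow_neg hx'.le]; norm_num
    rw [e2, rpow_neg_one, log_inv, smul_eq_mul]
    simp
    field_simp
    ring
  rw [setIntegral_congr_fun measurableSet_Ioi e, integral_neg] at h
  linarith

lemma integral_two_div_sq_add_four : ∫ y in Ioi (0 : ℝ), 2 / (y ^ 2 + 4) = π / 2 := by
  have h := integral_comp_mul_left_Ioi (fun y : ℝ => 2 / (y ^ 2 + 4)) 0 two_pos
  have e : ∀ x : ℝ, 2 / ((2 * x) ^ 2 + 4) = 2⁻¹ * (1 + x ^ 2)⁻¹ := fun x => by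
    field_simp; ring
  simp_rw [e, integral_const_mul, mul_zero] at h
  rw [integral_Ioi_inv_one_add_sq, smul_eq_mul, arctan_zero] at h
  linarith

lemma integral_log_mul_two_div_sq_add_four :
    IntegrableOn (fun y : ℝ => log y * (2 / (y ^ 2 + 4))) (Ioi 0) ∧
    ∫ y in Ioi (0 : ℝ), log y * (2 / (y ^ 2 + 4)) = π / 2 * log 2 := by
  have e : ∀ x ∈ Ioi (0 : ℝ), log (2 * x) * (2 / ((2 * x) ^ 2 + 4))
      = 2⁻¹ * (log x * (1 + x ^ 2)⁻¹) + 2⁻¹ * log 2 * (1 + x ^ 2)⁻¹ := fun x hx => by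
    rw [log_mul two_ne_zero (ne_of_gt hx)]
    field_simp
    ring
  have i1 := integrableOn_log_mul_inv_one_add_sq.const_mul 2⁻¹
  have i2 := (integrable_inv_one_add_sq.integrableOn (s := Ioi (0 : ℝ))).const_mul (2⁻¹ * log 2)
  constructor
  · have h := integrableOn_Ioi_comp_mul_left_iff (fun y : ℝ => log y * (2 / (y ^ 2 + 4))) 0 two_pos
    rw [mul_zero] at h
    rw [← h]
    exact (integrableOn_congr_fun e measurableSet_Ioi).2 (i1.add i2)
  · have h := integral_comp_mul_left_Ioi (fun y : ℝ => log y * (2 / (y ^ 2 + 4))) 0 two_pos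
    rw [setIntegral_congr_fun measurableSet_Ioi e, integral_add i1 i2, integral_const_mul,
      integral_const_mul, integral_log_mul_inv_one_add_sq, integral_Ioi_inv_one_add_sq, mul_zero,
      smul_eq_mul, mul_zero, arctan_zero] at h
    linarith

lemma integral_sinc_sq : ∫ x in Ioi (0 : ℝ), sinc x ^ 2 = π / 2 := by
  have h := integral_sin_sq_mul_laplace (w := fun _ => 1) measurable_const
    (by simpa using integrableOn_two_div_sq_add_four)
  simp only [mul_one, one_mul] at h
  rw [← integral_two_div_sq_add_four, ← h]
  refine setIntegral_congr_fun measurableSet_Ioi fun x hx => ?_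
  rw [integral_mul_exp_neg_mul hx, sinc_of_ne_zero (ne_of_gt hx)]
  ring

lemma integrableOn_sinc_sq : IntegrableOn (fun x => sinc x ^ 2) (Ioi 0) :=
  .of_integral_ne_zero (by rw [integral_sinc_sq]; positivity)

lemma sinc_sq_le_inv_sq {x : ℝ} (hx : 0 < x) : sinc x ^ 2 ≤ (x ^ 2)⁻¹ := by
  rw [← sq_abs, ← inv_pow, ← one_div]
  gcongr
  exact abs_sinc_le_inv hx

lemma sinc_sq_le_one (x : ℝ) : sinc x ^ 2 ≤ 1 := by
  rw [← sq_abs]; exact pow_le_one₀ (abs_nonneg _) (abs_sinc_le_one x)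

lemma integrableOn_sinc_sq_mul_log : IntegrableOn (fun x => sinc x ^ 2 * log x) (Ioi 0) := by
  refine integrableOn_Ioi_of_rpow_bounds (C := 2)
    ((continuous_sinc.pow 2).measurable.mul measurable_log).aestronglyMeasurable ?_ ?_
  · intro x h0 h1
    rw [abs_mul, abs_of_nonneg (sq_nonneg _)]
    exact (mul_le_of_le_one_left (abs_nonneg _) (sinc_sq_le_one x)).trans
      (abs_log_le_of_le_one h0 h1)
  · intro x h1
    rw [abs_mul, abs_of_nonneg (sq_nonneg _)]
    have h0 : 0 < x := by linarith
    have e : x ^ (-(3 / 2) : ℝ) = (x ^ 2)⁻¹ * x ^ (1 / 2 : ℝ) := by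
      rw [← rpow_natCast x 2, ← rpow_neg h0.le, ← rpow_add h0]; norm_num
    rw [e, mul_left_comm]
    exact mul_le_mul (sinc_sq_le_inv_sq h0) (abs_log_le_of_one_le h1.le) (abs_nonneg _)
      (by positivity)

/-- The Laplace transform of `y log y` is `(1 - γ - log x) / x²`, so the weighted Fubini identity is
a linear equation for the unknown integral. -/
lemma integral_sinc_sq_mul_log :
    ∫ x in Ioi (0 : ℝ), sinc x ^ 2 * log x
      = π / 2 * (1 - eulerMascheroniConstant - log 2) := by
  have h := integral_sin_sq_mul_laplace (w := log) measurable_log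
    integral_log_mul_two_div_sq_add_four.1
  rw [integral_log_mul_two_div_sq_add_four.2] at h
  have e : ∀ x ∈ Ioi (0 : ℝ), sin x ^ 2 * ∫ y in Ioi 0, y * log y * exp (-(x * y))
      = (1 - eulerMascheroniConstant) * sinc x ^ 2 - sinc x ^ 2 * log x := fun x hx => by
    rw [integral_mul_log_mul_exp_neg_mul hx, sinc_of_ne_zero (ne_of_gt hx)]
    ring
  rw [setIntegral_congr_fun measurableSet_Ioi e, integral_sub (integrableOn_sinc_sq.const_mul _)
    integrableOn_sinc_sq_mul_log, integral_const_mul, integral_sinc_sq] at h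
  linarith

lemma tendsto_integral_sinc_sq_mul_log :
    Tendsto (fun X => ∫ x in (0 : ℝ)..X, sinc x ^ 2 * log x) atTop
      (𝓝 (π / 2 * (1 - eulerMascheroniConstant - log 2))) := by
  rw [← integral_sinc_sq_mul_log]
  exact intervalIntegral_tendsto_integral_Ioi 0 integrableOn_sinc_sq_mul_log tendsto_id

lemma abs_integral_sinc_sq_sub_le {X : ℝ} (hX : 0 < X) :
    |(∫ x in (0 : ℝ)..X, sinc x ^ 2) - π / 2| ≤ 1 / X := by
  have h1 : (∫ x in (0 : ℝ)..X, sinc x ^ 2) - π / 2 = -∫ x in Ioi X, sinc x ^ 2 := by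
    rw [← integral_sinc_sq, intervalIntegral.integral_of_le hX.le,
      ← Ioc_union_Ioi_eq_Ioi hX.le, setIntegral_union (Ioc_disjoint_Ioi le_rfl) measurableSet_Ioi
      (integrableOn_sinc_sq.mono_set Ioc_subset_Ioi_self)
      (integrableOn_sinc_sq.mono_set (Ioi_subset_Ioi hX.le))]
    ring
  rw [h1, abs_neg, abs_of_nonneg (integral_nonneg fun x => sq_nonneg _)]
  have h2 := integral_Ioi_rpow_of_lt (a := -2) (by norm_num) hX
  have h3 : -X ^ ((-2 : ℝ) + 1) / (-2 + 1) = 1 / X := by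
    norm_num [rpow_neg_one]
  rw [← h3, ← h2]
  refine setIntegral_mono_on (integrableOn_sinc_sq.mono_set (Ioi_subset_Ioi hX.le))
    (integrableOn_Ioi_rpow_of_lt (by norm_num) hX) measurableSet_Ioi fun x hx => ?_
  have h0 : 0 < x := hX.trans hx
  rw [rpow_neg h0.le, rpow_two]
  exact sinc_sq_le_inv_sq h0

/-! ### The Dirichlet integral -/

/-- Both sides have derivative `2 sinc (2x)`, since `sinc (2x) = sinc x cos x`. This transfers the
quantitative convergence of the absolutely convergent `∫ sinc²` to the conditionally convergent
Dirichlet integral. -/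
lemma sinIntegral_two_mul (R : ℝ) :
    sinIntegral (2 * R) = (∫ x in (0 : ℝ)..R, sinc x ^ 2) + R * sinc R ^ 2 := by
  have hd : ∀ x ∈ uIcc 0 R, HasDerivAt (fun x => sinIntegral (2 * x) - x * sinc x ^ 2)
      (sinc x ^ 2) x := by
    intro x _
    have h2 : HasDerivAt (fun x : ℝ => 2 * x) 2 x := by
      simpa using (hasDerivAt_id x).const_mul 2
    have h := ((hasDerivAt_sinIntegral (2 * x)).comp x h2).sub
      ((hasDerivAt_id x).mul ((hasDerivAt_sinc x).pow 2))
    convert! h using 1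
    have e : sinc (2 * x) = sinc x * cos x := by
      rcases eq_or_ne x 0 with rfl | hx
      · simp
      · rw [sinc_of_ne_zero hx, sinc_of_ne_zero (by simpa using hx), sin_two_mul]
        field_simp
    have := mul_deriv_sinc x
    rw [e]
    simp only [id, Nat.cast_ofNat, Pi.pow_apply]
    linear_combination 2 * sinc x * this
  have := intervalIntegral.integral_eq_sub_of_hasDerivAt hd
    ((continuous_sinc.pow 2).intervalIntegrable _ _)
  rw [this]
  simp [sinIntegral_zero]

lemma abs_sinIntegral_sub_le {x : ℝ} (hx : 0 < x) : |sinIntegral x - π / 2| ≤ 4 / x := by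
  have h := sinIntegral_two_mul (x / 2)
  rw [mul_div_cancel₀ x two_ne_zero] at h
  have h1 := abs_integral_sinc_sq_sub_le (half_pos hx)
  have h2 : |x / 2 * sinc (x / 2) ^ 2| ≤ 1 / (x / 2) := by
    rw [abs_of_nonneg (by positivity)]
    have := mul_le_mul_of_nonneg_left (sinc_sq_le_inv_sq (half_pos hx)) (half_pos hx).le
    refine this.trans (le_of_eq ?_)
    field_simp
  rw [h, add_sub_right_comm]
  refine (abs_add_le _ _).trans ((add_le_add h1 h2).trans (le_of_eq ?_))
  field_simp
  norm_num

lemma abs_sinIntegral_le_six {x : ℝ} (hx : 0 ≤ x) : |sinIntegral x| ≤ 6 := by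
  rcases le_total x 1 with h | h
  · linarith [abs_sinIntegral_le hx]
  · have h1 := abs_sinIntegral_sub_le (show 0 < x by linarith)
    have h2 : 4 / x ≤ 4 := div_le_self (by norm_num) h
    have := abs_add_le (sinIntegral x - π / 2) (π / 2)
    rw [sub_add_cancel, abs_of_pos (by positivity : 0 < π / 2)] at this
    linarith [pi_le_four]

/-! ### Integration by parts against the logarithm -/

/-- Since `g 0 = 0`, `g` is `x` times its continuous slope at `0`. Hence `g log` extends
continuously to `0` through `x log x`, and `g / x` is integrable there. -/
lemma integral_deriv_mul_log {g g' : ℝ → ℝ} (hg : ∀ x, HasDerivAt g (g' x) x)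
    (hc : Continuous g') (h0 : g 0 = 0) {X : ℝ} (hX : 0 ≤ X) :
    ∫ x in (0 : ℝ)..X, g' x * log x = g X * log X - ∫ x in (0 : ℝ)..X, g x / x := by
  have hgc : Continuous g := continuous_iff_continuousAt.2 fun x => (hg x).continuousAt
  have hk : Continuous (dslope g 0) := by
    rw [← continuousOn_univ, continuousOn_dslope univ_mem]
    exact ⟨hgc.continuousOn, (hg 0).differentiableAt⟩
  have hgk : ∀ x, g x = x * dslope g 0 x := fun x => by
    have := sub_smul_dslope g 0 x
    simp [h0] at this
    exact this.symm
  have i1 : IntervalIntegrable (fun x => g' x * log x) volume 0 X :=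
    intervalIntegral.intervalIntegrable_log'.continuousOn_mul hc.continuousOn
  have i2 : IntervalIntegrable (fun x => g x / x) volume 0 X := by
    refine (hk.intervalIntegrable 0 X).congr_ae ?_
    refine ae_restrict_of_ae ?_
    have : ∀ᵐ t : ℝ, t ≠ 0 := by simp [ae_iff, measure_singleton]
    filter_upwards [this] with t ht
    rw [hgk t]; field_simp
  have h := intervalIntegral.integral_eq_sub_of_hasDerivAt_of_le hX
    (f := fun x => g x * log x) (f' := fun x => g' x * log x + g x / x) ?_ ?_ (i1.add i2)
  · rw [intervalIntegral.integral_add i1 i2] at h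
    simp only [h0, zero_mul, sub_zero] at h
    linarith
  · have : (fun x => g x * log x) = fun x => dslope g 0 x * (x * log x) := by
      funext x; rw [hgk x]; ring
    rw [this]
    exact (hk.mul continuous_mul_log).continuousOn
  · intro x hx
    have := (hg x).mul (hasDerivAt_log hx.1.ne')
    simpa [div_eq_mul_inv] using! this

lemma tendsto_log_div_atTop : Tendsto (fun x : ℝ => log x / x) atTop (𝓝 0) :=
  isLittleO_log_id_atTop.tendsto_div_nhds_zero

/-! ### The integral of `sinc' * log` -/

/-- The bracket is the Laplace transform of `sin x - x e^(-x)`. It is nonnegative, so the limit of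
an antiderivative gives integrability as well as the value. -/
lemma integral_one_add_sq_sub :
    IntegrableOn (fun y : ℝ => y * (1 / (1 + y ^ 2) - 1 / (1 + y) ^ 2)) (Ioi 0) ∧
    ∫ y in Ioi (0 : ℝ), y * (1 / (1 + y ^ 2) - 1 / (1 + y) ^ 2) = 1 := by
  have hd : ∀ y ∈ Ici (0 : ℝ), HasDerivAt
      (fun y => log (1 + y ^ 2) / 2 - log (1 + y) - 1 / (1 + y))
      (y * (1 / (1 + y ^ 2) - 1 / (1 + y) ^ 2)) y := by
    intro y hy
    have hy' : (0 : ℝ) ≤ y := hy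
    have a1 : HasDerivAt (fun y : ℝ => 1 + y ^ 2) (2 * y) y := by
      simpa using ((hasDerivAt_id y).pow 2).const_add 1
    have a2 : HasDerivAt (fun y : ℝ => 1 + y) 1 y := by
      simpa using (hasDerivAt_id y).const_add 1
    have n1 : 1 + y ^ 2 ≠ 0 := by positivity
    have n2 : 1 + y ≠ 0 := by positivity
    have := (((a1.log n1).div_const 2).sub (a2.log n2)).sub (a2.inv n2)
    simp only [one_div]
    convert! this using 1
    field_simp
    ring
  have hp : ∀ y ∈ Ioi (0 : ℝ), 0 ≤ y * (1 / (1 + y ^ 2) - 1 / (1 + y) ^ 2) := by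
    intro y hy
    have hy' : (0 : ℝ) < y := hy
    refine mul_nonneg hy'.le (sub_nonneg.2 ?_)
    gcongr
    nlinarith
  have ht : Tendsto (fun y : ℝ => log (1 + y ^ 2) / 2 - log (1 + y) - 1 / (1 + y)) atTop
      (𝓝 0) := by
    have hinv : Tendsto (fun y : ℝ => y⁻¹) atTop (𝓝 0) := tendsto_inv_atTop_zero
    have t1 : Tendsto (fun y : ℝ => log (1 + (y⁻¹) ^ 2) / 2 - log (1 + y⁻¹)) atTop
        (𝓝 (log (1 + 0 ^ 2) / 2 - log (1 + 0))) :=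
      (((hinv.pow 2).const_add 1).log (by norm_num)).div_const 2 |>.sub
        ((hinv.const_add 1).log (by norm_num))
    have t2 : Tendsto (fun y : ℝ => 1 / (1 + y)) atTop (𝓝 0) := by
      simp only [one_div]
      exact tendsto_inv_atTop_zero.comp (tendsto_atTop_add_const_left _ _ tendsto_id)
    have t3 := t1.sub t2
    norm_num at t3
    refine t3.congr' ?_
    filter_upwards [eventually_gt_atTop 0] with y hy
    have e1 : 1 + y ^ 2 = y ^ 2 * (1 + (y ^ 2)⁻¹) := by field_simp; ring
    have e2 : 1 + y = y * (1 + y⁻¹) := by field_simp; ring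
    have : log (1 + y ^ 2) / 2 - log (1 + y) = log (1 + (y ^ 2)⁻¹) / 2 - log (1 + y⁻¹) := by
      rw [e1, e2, log_mul (by positivity) (by positivity), log_mul (by positivity) (by positivity),
        log_pow]
      push_cast
      ring
    rw [this]
    simp
  refine ⟨integrableOn_Ioi_deriv_of_nonneg' hd hp ht, ?_⟩
  rw [integral_Ioi_of_hasDerivAt_of_nonneg' hd hp ht]
  simp

lemma abs_sin_sub_mul_exp_neg_le {x : ℝ} (hx : 0 ≤ x) : |sin x - x * exp (-x)| ≤ 2 * x ^ 2 := by
  have h1 : |sin x - x| ≤ x ^ 2 := by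
    rw [abs_sub_comm, abs_of_nonneg (sub_nonneg.2 (sin_le hx))]
    rcases le_total x 1 with h | h
    · rcases hx.eq_or_lt with rfl | h0
      · simp
      · have := sin_gt_sub_cube h0
        nlinarith [pow_pos h0 2]
    · rcases le_total x 2 with h2 | h2
      · have := sin_nonneg_of_nonneg_of_le_pi hx (by linarith [pi_gt_three])
        nlinarith
      · nlinarith [neg_one_le_sin x]
  have h2 : |x - x * exp (-x)| ≤ x ^ 2 := by
    have h3 : exp (-x) ≤ 1 := exp_le_one_iff.2 (by linarith)
    have h4 := add_one_le_exp (-x)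
    rw [abs_of_nonneg (by nlinarith)]
    nlinarith
  have := abs_add_le (sin x - x) (x - x * exp (-x))
  rw [sub_add_sub_cancel] at this
  linarith

lemma integrableOn_sin_sub_div_sq :
    IntegrableOn (fun x => (sin x - x * exp (-x)) * (1 / x ^ 2)) (Ioi 0) := by
  refine integrableOn_Ioi_of_rpow_bounds (C := 2)
    (by fun_prop) ?_ ?_
  · intro x h0 h1
    rw [abs_mul, abs_of_pos (show 0 < 1 / x ^ 2 by positivity), mul_one_div,
      div_le_iff₀ (by positivity)]
    refine (abs_sin_sub_mul_exp_neg_le h0.le).trans ?_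
    have : 1 ≤ x ^ (-(1 / 2) : ℝ) := one_le_rpow_of_pos_of_le_one_of_nonpos h0 h1 (by norm_num)
    nlinarith [pow_pos h0 2]
  · intro x h1
    have h0 : 0 < x := by linarith
    have h2 : |sin x - x * exp (-x)| ≤ 2 := by
      have h3 : x * exp (-x) ≤ 1 := by
        rw [exp_neg, ← div_eq_mul_inv, div_le_one (exp_pos _)]
        linarith [add_one_le_exp x]
      have h4 : 0 ≤ x * exp (-x) := by positivity
      rw [abs_le]
      constructor <;> linarith [sin_le_one x, neg_one_le_sin x]
    rw [abs_mul, abs_of_pos (show 0 < 1 / x ^ 2 by positivity)]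
    refine mul_le_mul h2 ?_ (by positivity) (by norm_num)
    rw [one_div, ← rpow_natCast x 2, ← rpow_neg h0.le]
    exact rpow_le_rpow_of_exponent_le h1.le (by norm_num)

/-- Fubini again, with `1/x²` as the Laplace transform of `y`. The subtracted `x e^(-x)` makes the
numerator `O(x²)` at the origin, which gives absolute convergence. -/
lemma integral_sin_sub_div_sq :
    ∫ x in Ioi 0, (sin x - x * exp (-x)) * (1 / x ^ 2) = 1 := by
  have hint : Integrable (Function.uncurry fun x y =>
      (sin x - x * exp (-x)) * (y * exp (-(x * y))))
      ((volume.restrict (Ioi 0)).prod (volume.restrict (Ioi 0))) := by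
    rw [integrable_prod_iff (by fun_prop)]
    constructor
    · refine (ae_restrict_iff' measurableSet_Ioi).2 (ae_of_all _ fun x hx => ?_)
      exact (integrableOn_mul_exp_neg_mul_self hx).const_mul (sin x - x * exp (-x))
    · refine integrableOn_sin_sub_div_sq.norm.congr ?_
      refine (ae_restrict_iff' measurableSet_Ioi).2 (ae_of_all _ fun x hx => ?_)
      have hx' : (0 : ℝ) < x := hx
      simp only [Function.uncurry]
      rw [norm_mul, norm_of_nonneg (show 0 ≤ 1 / x ^ 2 by positivity),
        ← integral_mul_exp_neg_mul hx, ← integral_const_mul]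
      refine setIntegral_congr_fun measurableSet_Ioi fun y hy => ?_
      have hy' : (0 : ℝ) < y := hy
      rw [norm_mul, norm_of_nonneg (show 0 ≤ y * exp (-(x * y)) by positivity)]
  have h := integral_integral_swap hint
  simp_rw [integral_const_mul] at h
  refine Eq.trans ?_ integral_one_add_sq_sub.2
  refine (setIntegral_congr_fun measurableSet_Ioi fun x hx => ?_).trans
    (h.trans (setIntegral_congr_fun measurableSet_Ioi fun y hy => ?_))
  · rw [integral_mul_exp_neg_mul hx]
  · have hy' : (0 : ℝ) < y := hy
    have e : ∀ x : ℝ, (sin x - x * exp (-x)) * (y * exp (-(x * y)))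
        = y * (sin x * exp (-(x * y)) - x * exp (-((1 + y) * x))) := fun x => by
      have : exp (-((1 + y) * x)) = exp (-x) * exp (-(x * y)) := by
        rw [← exp_add]; congr 1; ring
      rw [this]; ring
    simp only [e]
    rw [integral_const_mul, integral_sub
      (integrableOn_mul_exp_neg_mul hy (by fun_prop) abs_sin_le_one)
      (integrableOn_mul_exp_neg_mul_self (by positivity)), integral_sin_mul_exp_neg hy,
      integral_mul_exp_neg_mul (by positivity)]

lemma integrableOn_log_mul_exp_neg : IntegrableOn (fun y => log y * exp (-y)) (Ioi 0) := by
  refine .of_integral_ne_zero ?_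
  rw [integral_log_mul_exp_neg]
  have := one_half_lt_eulerMascheroniConstant
  linarith

/-- As `sinc 0 = 1`, `sinc` itself cannot be integrated by parts against `log`. Parts are applied to
`sinc x - e^(-x)`, which vanishes at `0`; the compensating `∫ e^(-x) log x = -γ` is a Gamma
derivative. -/
lemma tendsto_integral_deriv_sinc_mul_log :
    Tendsto (fun X => ∫ x in (0 : ℝ)..X, deriv sinc x * log x) atTop
      (𝓝 (eulerMascheroniConstant - 1)) := by
  have hexp : ∀ x : ℝ, HasDerivAt (fun x : ℝ => exp (-x)) (-exp (-x)) x := fun x => by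
    simpa using (hasDerivAt_neg x).exp
  have t1 : Tendsto (fun X => ∫ x in (0 : ℝ)..X, log x * exp (-x)) atTop
      (𝓝 (-eulerMascheroniConstant)) := by
    rw [← integral_log_mul_exp_neg]
    exact intervalIntegral_tendsto_integral_Ioi 0 integrableOn_log_mul_exp_neg tendsto_id
  have t2 : Tendsto (fun X => ∫ x in (0 : ℝ)..X, (sinc x - exp (-x)) / x) atTop (𝓝 1) := by
    rw [← integral_sin_sub_div_sq]
    refine (intervalIntegral_tendsto_integral_Ioi 0 integrableOn_sin_sub_div_sq
      tendsto_id).congr' ?_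
    filter_upwards [eventually_ge_atTop 0] with X hX
    refine intervalIntegral.integral_congr_ae (ae_of_all _ fun x hx => ?_)
    rw [id, uIoc_of_le hX] at hx
    have := hx.1
    rw [sinc_of_ne_zero hx.1.ne']
    field_simp
  have t3 : Tendsto (fun X => (sinc X - exp (-X)) * log X) atTop (𝓝 0) := by
    refine squeeze_zero_norm' ?_ (by simpa using tendsto_log_div_atTop.const_mul 2)
    filter_upwards [eventually_ge_atTop 1] with X hX
    have h0 : 0 < X := by linarith
    have h1 := abs_sinc_le_inv h0
    have h2 : |exp (-X)| ≤ 1 / X := by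
      rw [abs_exp, exp_neg, ← one_div]
      exact one_div_le_one_div_of_le h0 (by linarith [add_one_le_exp X])
    have h3 := abs_sub (sinc X) (exp (-X))
    rw [norm_mul, norm_eq_abs, norm_of_nonneg (log_nonneg hX)]
    calc |sinc X - exp (-X)| * log X ≤ (2 / X) * log X := by
          refine mul_le_mul_of_nonneg_right ?_ (log_nonneg hX)
          have : 2 / X = 1 / X + 1 / X := by ring
          linarith
      _ = 2 * (log X / X) := by ring
  have key := (t3.sub t2).sub t1
  have : (0 : ℝ) - 1 - -eulerMascheroniConstant = eulerMascheroniConstant - 1 := by ring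
  rw [this] at key
  refine key.congr' ?_
  filter_upwards [eventually_ge_atTop 0] with X hX
  have h := integral_deriv_mul_log (g := fun x => sinc x - exp (-x))
    (g' := fun x => deriv sinc x - -exp (-x)) (fun x => (hasDerivAt_sinc x).sub (hexp x))
    (continuous_deriv_sinc.sub (by fun_prop)) (by simp) hX
  rw [← h]
  rw [← intervalIntegral.integral_sub]
  · refine intervalIntegral.integral_congr fun x _ => ?_
    ring
  · exact intervalIntegral.intervalIntegrable_log'.continuousOn_mul
      (continuous_deriv_sinc.sub (by fun_prop)).continuousOn
  · exact intervalIntegral.intervalIntegrable_log'.mul_continuousOn (by fun_prop)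

/-! ### The integral of `(sinc * sinIntegral)' * log` -/

lemma integral_sq_mul_sinc_mul_sq {a : ℝ} (ha : 0 ≤ a) :
    IntegrableOn (fun x => a ^ 2 * sinc (a * x) ^ 2) (Ioi 0) ∧
    ∫ x in Ioi (0 : ℝ), a ^ 2 * sinc (a * x) ^ 2 = a * (π / 2) := by
  rcases ha.eq_or_lt with rfl | ha
  · simp
  · have h := integral_comp_mul_left_Ioi (fun x => sinc x ^ 2) 0 ha
    have h' := integrableOn_Ioi_comp_mul_left_iff (fun x => sinc x ^ 2) 0 ha
    rw [mul_zero] at h h'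
    refine ⟨(h'.2 integrableOn_sinc_sq).const_mul _, ?_⟩
    rw [integral_const_mul, h, integral_sinc_sq, smul_eq_mul]
    field_simp

/-- With `A = (1+t)x/2` and `B = (1-t)x/2`, `sin x sin (t x) = sin² A - sin² B`. Each square
integrates against `1/x²` to a linear function of its frequency, and the difference of the
frequencies is `t`, which cancels the prefactor `1/t`. -/
lemma integral_sinc_mul_sinc_mul {t : ℝ} (h0 : 0 < t) (h1 : t ≤ 1) :
    ∫ x in Ioi (0 : ℝ), sinc x * sinc (t * x) = π / 2 := by
  obtain ⟨ia, ea⟩ := integral_sq_mul_sinc_mul_sq (a := (1 + t) / 2) (by linarith)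
  obtain ⟨ib, eb⟩ := integral_sq_mul_sinc_mul_sq (a := (1 - t) / 2) (by linarith)
  have e : ∀ x ∈ Ioi (0 : ℝ), sinc x * sinc (t * x)
      = t⁻¹ * (((1 + t) / 2) ^ 2 * sinc ((1 + t) / 2 * x) ^ 2
        - ((1 - t) / 2) ^ 2 * sinc ((1 - t) / 2 * x) ^ 2) := by
    intro x hx
    have hx' : x ≠ 0 := ne_of_gt hx
    have s1 := mul_sinc x
    have s2 := mul_sinc (t * x)
    have s3 := mul_sinc ((1 + t) / 2 * x)
    have s4 := mul_sinc ((1 - t) / 2 * x)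
    have k : sin x * sin (t * x) = sin ((1 + t) / 2 * x) ^ 2 - sin ((1 - t) / 2 * x) ^ 2 := by
      have e1 : x = (1 + t) / 2 * x + (1 - t) / 2 * x := by ring
      have e2 : t * x = (1 + t) / 2 * x - (1 - t) / 2 * x := by ring
      generalize (1 + t) / 2 * x = A at *
      generalize (1 - t) / 2 * x = B at *
      rw [e2, e1, sin_add, sin_sub]
      nlinarith [sin_sq_add_cos_sq A, sin_sq_add_cos_sq B]
    rw [← s1, ← s2, ← s3, ← s4] at k
    rw [eq_inv_mul_iff_mul_eq₀ h0.ne']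
    refine mul_left_cancel₀ (pow_ne_zero 2 hx') ?_
    linear_combination k
  rw [setIntegral_congr_fun measurableSet_Ioi e, integral_const_mul, integral_sub ia ib, ea, eb]
  field_simp
  ring

/-- The exponent `1/2` makes the bound on `sinc (t x)` a product of a function of `t` and one of
`x`, each integrable where Fubini needs it. -/
lemma abs_sinc_le_rpow {x : ℝ} (hx : 0 < x) : |sinc x| ≤ x ^ (-(1 / 2) : ℝ) := by
  rcases le_total x 1 with h | h
  · exact (abs_sinc_le_one x).trans
      (one_le_rpow_of_pos_of_le_one_of_nonpos hx h (by norm_num))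
  · refine (abs_sinc_le_inv hx).trans ?_
    rw [one_div, ← rpow_neg_one]
    exact rpow_le_rpow_of_exponent_le h (by norm_num)

lemma sinIntegral_div (x : ℝ) (hx : x ≠ 0) :
    sinIntegral x / x = ∫ t in Ioc (0 : ℝ) 1, sinc (t * x) := by
  rw [← intervalIntegral.integral_of_le zero_le_one, intervalIntegral.integral_comp_mul_right _ hx]
  simp [sinIntegral, div_eq_inv_mul]

lemma integral_sinc_mul_sinIntegral_div :
    IntegrableOn (fun x => sinc x * sinIntegral x / x) (Ioi 0) ∧
    ∫ x in Ioi (0 : ℝ), sinc x * sinIntegral x / x = π / 2 := by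
  have hint : Integrable (Function.uncurry fun x t : ℝ => sinc x * sinc (t * x))
      ((volume.restrict (Ioi 0)).prod (volume.restrict (Ioc 0 1))) := by
    have b1 : IntegrableOn (fun x => |sinc x| * x ^ (-(1 / 2) : ℝ)) (Ioi 0) := by
      refine integrableOn_Ioi_of_rpow_bounds (C := 1)
        ((continuous_sinc.abs.measurable).mul (by fun_prop)).aestronglyMeasurable ?_ ?_
      · intro x h0 h1
        rw [abs_of_nonneg (by positivity)]
        gcongr
        exact abs_sinc_le_one x
      · intro x h1
        have h0 : 0 < x := by linarith
        rw [abs_of_nonneg (by positivity), one_mul]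
        have : x ^ (-(3 / 2) : ℝ) = 1 / x * x ^ (-(1 / 2) : ℝ) := by
          rw [one_div, ← rpow_neg_one, ← rpow_add h0]; norm_num
        rw [this]
        gcongr
        exact abs_sinc_le_inv h0
    have b2 : IntegrableOn (fun t : ℝ => t ^ (-(1 / 2) : ℝ)) (Ioc 0 1) := by
      have := intervalIntegral.intervalIntegrable_rpow' (a := 0) (b := 1)
        (show (-1 : ℝ) < -(1 / 2) by norm_num)
      rwa [intervalIntegrable_iff_integrableOn_Ioc_of_le zero_le_one] at this
    refine Integrable.mono' (Integrable.mul_prod b1 b2) ?_ ?_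
    · exact Continuous.aestronglyMeasurable
        ((continuous_sinc.comp continuous_fst).mul
          (continuous_sinc.comp (continuous_snd.mul continuous_fst)))
    · rw [Measure.prod_restrict]
      refine (ae_restrict_iff' (measurableSet_Ioi.prod measurableSet_Ioc)).2
        (ae_of_all _ fun z hz => ?_)
      have hx : 0 < z.1 := hz.1
      have ht : 0 < z.2 := hz.2.1
      simp only [Function.uncurry]
      rw [norm_mul, norm_eq_abs, norm_eq_abs, mul_assoc]
      gcongr
      rw [← mul_rpow hx.le ht.le, mul_comm]
      exact abs_sinc_le_rpow (by positivity)
  have e : ∀ x ∈ Ioi (0 : ℝ), ∫ t in Ioc (0 : ℝ) 1, sinc x * sinc (t * x)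
      = sinc x * sinIntegral x / x := fun x hx => by
    rw [integral_const_mul, ← sinIntegral_div x (ne_of_gt hx), mul_div_assoc]
  constructor
  · exact (integrableOn_congr_fun e measurableSet_Ioi).1 hint.integral_prod_left
  · rw [← setIntegral_congr_fun measurableSet_Ioi e, integral_integral_swap hint,
      setIntegral_congr_fun measurableSet_Ioc fun t ht =>
        integral_sinc_mul_sinc_mul ht.1 ht.2]
    simp

lemma hasDerivAt_sinc_mul_sinIntegral (x : ℝ) :
    HasDerivAt (fun x => sinc x * sinIntegral x)
      (deriv sinc x * sinIntegral x + sinc x * sinc x) x :=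
  (hasDerivAt_sinc x).mul (hasDerivAt_sinIntegral x)

lemma continuous_deriv_sinc_mul_sinIntegral :
    Continuous fun x => deriv sinc x * sinIntegral x + sinc x * sinc x :=
  (continuous_deriv_sinc.mul continuous_sinIntegral).add (continuous_sinc.mul continuous_sinc)

/-- Integration by parts; the boundary term is `O(log X / X)` because `Si` is bounded. -/
lemma tendsto_integral_deriv_sinc_mul_sinIntegral_mul_log :
    Tendsto (fun X => ∫ x in (0 : ℝ)..X,
      (deriv sinc x * sinIntegral x + sinc x * sinc x) * log x) atTop (𝓝 (-(π / 2))) := by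
  have t2 : Tendsto (fun X => ∫ x in (0 : ℝ)..X, sinc x * sinIntegral x / x) atTop
      (𝓝 (π / 2)) := by
    rw [← integral_sinc_mul_sinIntegral_div.2]
    exact intervalIntegral_tendsto_integral_Ioi 0 integral_sinc_mul_sinIntegral_div.1 tendsto_id
  have t3 : Tendsto (fun X => sinc X * sinIntegral X * log X) atTop (𝓝 0) := by
    refine squeeze_zero_norm' ?_ (by simpa using tendsto_log_div_atTop.const_mul 6)
    filter_upwards [eventually_ge_atTop 1] with X hX
    have h0 : 0 < X := by linarith
    rw [norm_mul, norm_mul, norm_eq_abs, norm_eq_abs, norm_of_nonneg (log_nonneg hX)]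
    calc |sinc X| * |sinIntegral X| * log X ≤ (1 / X * 6) * log X := by
          refine mul_le_mul_of_nonneg_right ?_ (log_nonneg hX)
          exact mul_le_mul (abs_sinc_le_inv h0) (abs_sinIntegral_le_six h0.le) (abs_nonneg _)
            (by positivity)
      _ = 6 * (log X / X) := by ring
  have key := t3.sub t2
  rw [zero_sub] at key
  refine key.congr' ?_
  filter_upwards [eventually_ge_atTop 0] with X hX
  exact (integral_deriv_mul_log hasDerivAt_sinc_mul_sinIntegral
    continuous_deriv_sinc_mul_sinIntegral (by simp [sinIntegral_zero]) hX).symm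

end Real

/-! ### Improper integrals of even functions -/

lemma locallyIntegrable_of_intervalIntegrable {g : ℝ → ℝ}
    (hg : ∀ a b, IntervalIntegrable g volume a b) : LocallyIntegrable g := fun x =>
  ⟨Ioc (x - 1) (x + 1), Ioc_mem_nhds (by linarith) (by linarith),
    (intervalIntegrable_iff_integrableOn_Ioc_of_le (by linarith)).1 (hg _ _)⟩

lemma integral_zero_neg_of_even {g : ℝ → ℝ} (he : ∀ v, g (-v) = g v) (a : ℝ) :
    ∫ v in (0 : ℝ)..(-a), g v = -∫ v in (0 : ℝ)..a, g v := by
  have h := intervalIntegral.integral_comp_neg (a := 0) (b := a) g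
  simp only [he, neg_zero] at h
  rw [h, intervalIntegral.integral_symm]

lemma hasImproperIntegral_of_even {g : ℝ → ℝ} {l : ℝ} (he : ∀ v, g (-v) = g v)
    (hi : ∀ a b, IntervalIntegrable g volume a b)
    (hl : Tendsto (fun R => ∫ v in (0 : ℝ)..R, g v) atTop (𝓝 l)) :
    HasImproperIntegral g (2 * l) := by
  refine ⟨locallyIntegrable_of_intervalIntegrable hi, ?_⟩
  have h1 : Tendsto (fun p : ℝ × ℝ => ∫ v in (0 : ℝ)..(-p.1), g v) (atBot ×ˢ atTop) (𝓝 l) :=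
    hl.comp (tendsto_neg_atBot_atTop.comp tendsto_fst)
  have h2 : Tendsto (fun p : ℝ × ℝ => ∫ v in (0 : ℝ)..p.2, g v) (atBot ×ˢ atTop) (𝓝 l) :=
    hl.comp tendsto_snd
  have h3 := h1.add h2
  rw [← two_mul] at h3
  refine h3.congr fun p => ?_
  rw [integral_zero_neg_of_even he,
    ← intervalIntegral.integral_interval_sub_left (hi 0 p.2) (hi 0 p.1)]
  ring

/-! ### The kernel `log |2 sin (π v / N)|` -/

/-- Jordan's inequality at whichever end of `[0, N]` is nearer. Adding the bounds for both ends
avoids a case split later and integrates to logarithms. -/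
lemma inv_sin_le {N v : ℝ} (h0 : 0 < v) (h1 : v < N) :
    0 < Real.sin (Real.pi * v / N) ∧
    1 / Real.sin (Real.pi * v / N) ≤ N / 2 * (1 / v + 1 / (N - v)) := by
  have hN : 0 < N := h0.trans h1
  have hs : 0 < Real.sin (Real.pi * v / N) := by
    apply Real.sin_pos_of_pos_of_lt_pi
    · positivity
    · rw [div_lt_iff₀ hN]; exact mul_lt_mul_of_pos_left h1 Real.pi_pos
  have low : ∀ w, 0 < w → w ≤ N / 2 → 2 * w / N ≤ Real.sin (Real.pi * w / N) := by
    intro w hw hw'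
    have := Real.mul_le_sin (x := Real.pi * w / N) (by positivity) (by
      rw [div_le_div_iff₀ hN two_pos]; nlinarith [Real.pi_pos])
    refine le_trans (le_of_eq ?_) this
    field_simp
  refine ⟨hs, ?_⟩
  have hNv : 0 < N - v := by linarith
  rcases le_total v (N / 2) with h | h
  · calc 1 / Real.sin (Real.pi * v / N) ≤ 1 / (2 * v / N) :=
          one_div_le_one_div_of_le (by positivity) (low v h0 h)
      _ = N / 2 * (1 / v + 0) := by field_simp; ring
      _ ≤ _ := by gcongr; positivity
  · have e : Real.sin (Real.pi * v / N) = Real.sin (Real.pi * (N - v) / N) := by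
      rw [← Real.sin_pi_sub]; congr 1; field_simp
    rw [e]
    calc 1 / Real.sin (Real.pi * (N - v) / N) ≤ 1 / (2 * (N - v) / N) :=
          one_div_le_one_div_of_le (by positivity) (low _ hNv (by linarith))
      _ = N / 2 * (0 + 1 / (N - v)) := by field_simp; ring
      _ ≤ _ := by gcongr; positivity

lemma intervalIntegrable_log_two_sin {N : ℝ} (a b : ℝ) :
    IntervalIntegrable (fun v => Real.log |2 * Real.sin (Real.pi * v / N)|) volume a b := by
  have h : AnalyticOnNhd ℝ (fun v => 2 * Real.sin (Real.pi * v / N)) (uIcc a b) := by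
    intro x _
    have : AnalyticAt ℝ (fun v : ℝ => Real.pi * v / N) x := by fun_prop
    exact analyticAt_const.mul (Real.analyticAt_sin.comp this)
  simpa using h.meromorphicOn.intervalIntegrable_log_norm

lemma intervalIntegrable_mul_log_two_sin {T : ℝ → ℝ} (hT : Continuous T) {N : ℝ} (a b : ℝ) :
    IntervalIntegrable (fun v => T v * Real.log |2 * Real.sin (Real.pi * v / N)|) volume a b :=
  (intervalIntegrable_log_two_sin a b).continuousOn_mul hT.continuousOn

lemma abs_log_two_sin_le_log {N α v : ℝ} (hα : 1 ≤ α) (h0 : α ≤ v) (h1 : v ≤ N - α) :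
    |(Real.log |2 * Real.sin (Real.pi * v / N)|)| ≤ 2 * Real.log N := by
  obtain ⟨hs, hi⟩ := inv_sin_le (N := N) (v := v) (by linarith) (by linarith)
  have hN : 2 ≤ N := by linarith
  have hlow : 1 / N ≤ Real.sin (Real.pi * v / N) := by
    rw [div_le_iff₀ (by linarith), ← div_le_iff₀' hs]
    refine hi.trans ?_
    have a1 : 1 / v ≤ 1 := by rw [div_le_one (by linarith)]; linarith
    have a2 : 1 / (N - v) ≤ 1 := by rw [div_le_one (by linarith)]; linarith
    nlinarith
  have hl2 : Real.log 2 ≤ Real.log N := Real.log_le_log two_pos hN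
  have hl0 : 0 ≤ Real.log N := Real.log_nonneg (by linarith)
  rw [Real.log_abs, abs_le]
  constructor
  · have : Real.log (1 / N) ≤ Real.log (2 * Real.sin (Real.pi * v / N)) :=
      Real.log_le_log (by positivity) (by linarith)
    rw [one_div, Real.log_inv] at this
    linarith
  · have : Real.log (2 * Real.sin (Real.pi * v / N)) ≤ Real.log 2 :=
      Real.log_le_log (by positivity) (by linarith [Real.sin_le_one (Real.pi * v / N)])
    linarith

lemma hasDerivAt_log_two_sin {N v : ℝ} (h0 : 0 < v) (h1 : v < N) :
    HasDerivAt (fun v => Real.log |2 * Real.sin (Real.pi * v / N)|)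
      (Real.pi / N * (Real.cos (Real.pi * v / N) / Real.sin (Real.pi * v / N))) v := by
  have hs := (inv_sin_le h0 h1).1
  simp only [Real.log_abs]
  have h : HasDerivAt (fun v : ℝ => Real.pi * v / N) (Real.pi / N) v := by
    simpa using ((hasDerivAt_id v).const_mul Real.pi).div_const N
  have := ((h.sin).const_mul 2).log (by positivity)
  convert! this using 1
  field_simp

/-- Integration by parts against `log |2 sin (π v / N)|`. -/
lemma abs_integral_mul_log_two_sin_le {T : ℝ → ℝ} (hT : Continuous T) {C : ℝ}
    (hC : ∀ v, 0 < v → |(∫ u in (0 : ℝ)..v, T u) - 1 / 2| ≤ C / v)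
    {N α A : ℝ} (hα : 1 ≤ α) (h0 : α ≤ A) (h1 : A ≤ N - α) :
    |(∫ v in α..A, T v * Real.log |2 * Real.sin (Real.pi * v / N)|)|
      ≤ 8 * C * (Real.log N / α) := by
  have hα0 : 0 < α := by linarith
  have hC0 : 0 ≤ C := by
    have := (abs_nonneg _).trans (hC 1 one_pos); simpa using this
  have hN : 2 ≤ N := by linarith
  have hl0 : 0 ≤ Real.log N := Real.log_nonneg (by linarith)
  -- Subtracting the limit `1/2` makes the primitive of `T` small, of size `C/α`, beyond `α`.
  set u : ℝ → ℝ := fun v => (∫ t in (0 : ℝ)..v, T t) - 1 / 2 with hu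
  set φ : ℝ → ℝ := fun v => Real.log |2 * Real.sin (Real.pi * v / N)| with hφ
  set φ' : ℝ → ℝ := fun v =>
    Real.pi / N * (Real.cos (Real.pi * v / N) / Real.sin (Real.pi * v / N)) with hφ'
  have hdu : ∀ v ∈ uIcc α A, HasDerivAt u (T v) v := fun v _ =>
    (intervalIntegral.integral_hasDerivAt_right (hT.intervalIntegrable _ _)
      hT.stronglyMeasurable.stronglyMeasurableAtFilter hT.continuousAt).sub_const _
  have hdφ : ∀ v ∈ uIcc α A, HasDerivAt φ (φ' v) v := by
    intro v hv
    rw [uIcc_of_le h0] at hv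
    exact hasDerivAt_log_two_sin (by linarith [hv.1]) (by linarith [hv.2])
  have hub : ∀ v, α ≤ v → |u v| ≤ C / α := fun v hv =>
    (hC v (by linarith)).trans (by gcongr)
  have hφ'c : ContinuousOn φ' (uIcc α A) := by
    refine ContinuousOn.mul continuousOn_const (ContinuousOn.div (by fun_prop) (by fun_prop) ?_)
    intro v hv
    rw [uIcc_of_le h0] at hv
    exact (inv_sin_le (N := N) (v := v) (by linarith [hv.1]) (by linarith [hv.2])).1.ne'
  have ibp := intervalIntegral.integral_mul_deriv_eq_deriv_mul hdφ hdu
    hφ'c.intervalIntegrable (hT.intervalIntegrable _ _)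
  have e : ∫ v in α..A, T v * φ v = ∫ v in α..A, φ v * T v := by simp_rw [mul_comm]
  have b1 : |φ A * u A| ≤ 2 * Real.log N * (C / α) := by
    rw [abs_mul]
    exact mul_le_mul (abs_log_two_sin_le_log hα h0 h1) (hub A h0) (abs_nonneg _) (by positivity)
  have b2 : |φ α * u α| ≤ 2 * Real.log N * (C / α) := by
    rw [abs_mul]
    exact mul_le_mul (abs_log_two_sin_le_log hα le_rfl (h0.trans h1)) (hub α le_rfl)
      (abs_nonneg _) (by positivity)
  have i1 : IntervalIntegrable (fun v : ℝ => v⁻¹) volume α A := by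
    refine ContinuousOn.intervalIntegrable (continuousOn_inv₀.mono fun v hv => ?_)
    rw [uIcc_of_le h0] at hv
    have := hv.1
    exact (show 0 < v by linarith).ne'
  have i2 : IntervalIntegrable (fun v : ℝ => (N - v)⁻¹) volume α A := by
    refine ContinuousOn.intervalIntegrable (ContinuousOn.inv₀ (by fun_prop) fun v hv => ?_)
    rw [uIcc_of_le h0] at hv
    have := hv.2
    exact (show 0 < N - v by linarith).ne'
  have b3 : |(∫ v in α..A, φ' v * u v)| ≤ C / α * (Real.pi / 2) * (2 * Real.log N) := by
    have hle : |(∫ v in α..A, φ' v * u v)|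
        ≤ ∫ v in α..A, C / α * (Real.pi / 2) * (v⁻¹ + (N - v)⁻¹) := by
      rw [← Real.norm_eq_abs]
      refine intervalIntegral.norm_integral_le_of_norm_le h0 (ae_of_all _ fun v hv => ?_)
        ((i1.add i2).const_mul _)
      obtain ⟨hs, hi⟩ := inv_sin_le (N := N) (v := v) (by linarith [hv.1]) (by linarith [hv.2])
      have hφ'b : |φ' v| ≤ Real.pi / 2 * (v⁻¹ + (N - v)⁻¹) := by
        simp only [hφ']
        rw [abs_mul, abs_of_pos (show 0 < Real.pi / N by positivity), abs_div, abs_of_pos hs]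
        calc Real.pi / N * (|Real.cos (Real.pi * v / N)| / Real.sin (Real.pi * v / N))
            ≤ Real.pi / N * (1 / Real.sin (Real.pi * v / N)) := by
              gcongr; exact Real.abs_cos_le_one _
          _ ≤ Real.pi / N * (N / 2 * (1 / v + 1 / (N - v))) := by gcongr
          _ = _ := by field_simp
      rw [norm_mul, Real.norm_eq_abs, Real.norm_eq_abs]
      calc |φ' v| * |u v| ≤ (Real.pi / 2 * (v⁻¹ + (N - v)⁻¹)) * (C / α) :=
            mul_le_mul hφ'b (hub v hv.1.le) (abs_nonneg _) ((abs_nonneg _).trans hφ'b)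
        _ = _ := by ring
    refine hle.trans ?_
    rw [intervalIntegral.integral_const_mul, intervalIntegral.integral_add i1 i2,
      intervalIntegral.integral_comp_sub_left (fun v => v⁻¹) N,
      integral_inv_of_pos hα0 (by linarith), integral_inv_of_pos (by linarith) (by linarith)]
    have l1 : Real.log (A / α) ≤ Real.log N :=
      Real.log_le_log (div_pos (by linarith) hα0) ((div_le_self (by linarith) hα).trans (by linarith))
    have l2 : Real.log ((N - α) / (N - A)) ≤ Real.log N :=
      Real.log_le_log (div_pos (by linarith) (by linarith))
        ((div_le_self (by linarith) (by linarith)).trans (by linarith))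
    gcongr
    linarith
  rw [e, ibp]
  have t1 := abs_sub (φ A * u A - φ α * u α) (∫ v in α..A, φ' v * u v)
  have t2 := abs_sub (φ A * u A) (φ α * u α)
  -- The constant `8` is `2 + 2` from the boundary terms and `4 ≥ π` from the integral.
  have hpi : C / α * (Real.pi / 2) * (2 * Real.log N) ≤ 4 * Real.log N * (C / α) := by
    have : 0 ≤ C / α * Real.log N := by positivity
    nlinarith [Real.pi_le_four]
  have : 8 * C * (Real.log N / α) = 8 * Real.log N * (C / α) := by ring
  rw [this]
  linarith

/-- A crude integrable majorant of the logarithmic singularity. Its integral over an edge of length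
`α` is `O(√(N α))`, which is enough because the edge is averaged with weight `α / N`. -/
lemma abs_log_two_sin_le_rpow {N v : ℝ} (h0 : 0 < v) (h1 : v ≤ N / 2) :
    |(Real.log |2 * Real.sin (Real.pi * v / N)|)| ≤ 1 + √N * v ^ (-(1 / 2) : ℝ) := by
  have hN : 0 < N := by linarith
  have hlow : 4 * v / N ≤ 2 * Real.sin (Real.pi * v / N) := by
    have := Real.mul_le_sin (x := Real.pi * v / N) (by positivity) (by
      rw [div_le_div_iff₀ hN two_pos]; nlinarith [Real.pi_pos])
    have e : 2 / Real.pi * (Real.pi * v / N) = 2 * v / N := by field_simp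
    rw [e] at this
    have e' : 4 * v / N = 2 * (2 * v / N) := by ring
    linarith
  have hpos : 0 < 4 * v / N := by positivity
  rw [Real.log_abs]
  rcases le_total 1 (2 * Real.sin (Real.pi * v / N)) with h | h
  · rw [abs_of_nonneg (Real.log_nonneg h)]
    have a1 : Real.log (2 * Real.sin (Real.pi * v / N)) ≤ Real.log 2 :=
      Real.log_le_log (by positivity) (by linarith [Real.sin_le_one (Real.pi * v / N)])
    have a2 := Real.log_two_lt_d9
    have a3 : 0 ≤ √N * v ^ (-(1 / 2) : ℝ) := by positivity
    linarith
  · refine (abs_log_le_of_le_one (hpos.trans_le hlow) h).trans ?_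
    have a1 : (2 * Real.sin (Real.pi * v / N)) ^ (-(1 / 2) : ℝ) ≤ (4 * v / N) ^ (-(1 / 2) : ℝ) :=
      Real.rpow_le_rpow_of_nonpos hpos hlow (by norm_num)
    have a2 : (4 * v / N) ^ (-(1 / 2) : ℝ) = 1 / 2 * (√N * v ^ (-(1 / 2) : ℝ)) := by
      rw [Real.rpow_neg hpos.le, ← Real.sqrt_eq_rpow, Real.rpow_neg h0.le, ← Real.sqrt_eq_rpow,
        Real.sqrt_div (by positivity), Real.sqrt_mul (by norm_num),
        show (4 : ℝ) = 2 ^ 2 by norm_num, Real.sqrt_sq (by norm_num)]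
      field_simp
    linarith

lemma integral_abs_log_two_sin_le {N α : ℝ} (h0 : 0 ≤ α) (h1 : α ≤ N / 2) :
    ∫ v in (0 : ℝ)..α, |(Real.log |2 * Real.sin (Real.pi * v / N)|)| ≤ 3 * √(N * α) := by
  have hr : IntervalIntegrable (fun v : ℝ => v ^ (-(1 / 2) : ℝ)) volume 0 α :=
    intervalIntegral.intervalIntegrable_rpow' (by norm_num)
  have hm : ∫ v in (0 : ℝ)..α, |(Real.log |2 * Real.sin (Real.pi * v / N)|)|
      ≤ ∫ v in (0 : ℝ)..α, (1 + √N * v ^ (-(1 / 2) : ℝ)) := by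
    rw [intervalIntegral.integral_of_le h0, intervalIntegral.integral_of_le h0]
    refine setIntegral_mono_on ?_ ?_ measurableSet_Ioc fun v hv =>
      abs_log_two_sin_le_rpow hv.1 (hv.2.trans h1)
    · exact ((intervalIntegrable_iff_integrableOn_Ioc_of_le h0).1
        (intervalIntegrable_log_two_sin 0 α)).norm
    · exact (intervalIntegrable_iff_integrableOn_Ioc_of_le h0).1
        (intervalIntegrable_const.add (hr.const_mul _))
  refine hm.trans ?_
  rw [intervalIntegral.integral_add intervalIntegrable_const (hr.const_mul _),
    intervalIntegral.integral_const_mul, integral_rpow (Or.inl (by norm_num))]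
  have e : (-(1 / 2) + 1 : ℝ) = 1 / 2 := by norm_num
  rw [e, Real.zero_rpow (by norm_num), ← Real.sqrt_eq_rpow, Real.sqrt_mul (by linarith)]
  have : α ≤ √N * √α := by
    rw [← Real.sqrt_mul (by linarith)]
    exact Real.le_sqrt_of_sq_le (by nlinarith)
  simp
  linarith

/-- Use `log (x / sin x) ≤ x / sin x - 1` together with the cubic lower bound for the sine. -/
lemma abs_log_sin_sub_log_le {x : ℝ} (h0 : 0 < x) (h1 : x ≤ 1) :
    |Real.log (Real.sin x) - Real.log x| ≤ x ^ 2 := by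
  have hc := Real.sin_gt_sub_cube h0
  have hs : 0 < Real.sin x := Real.sin_pos_of_pos_of_lt_pi h0 (by linarith [Real.pi_gt_three])
  have hle : Real.log (Real.sin x) ≤ Real.log x := Real.log_le_log hs (Real.sin_lt h0).le
  rw [abs_of_nonpos (by linarith), neg_sub, ← Real.log_div h0.ne' hs.ne']
  refine (Real.log_le_sub_one_of_pos (by positivity)).trans ?_
  rw [sub_le_iff_le_add, div_le_iff₀ hs]
  have h2 : 0 < x ^ 2 := by positivity
  have h3 : x ^ 2 ≤ 1 := by nlinarith
  have : (x ^ 2 + 1) * (x - x ^ 3 / 6) ≤ (x ^ 2 + 1) * Real.sin x := by gcongr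
  have h5 : x ≤ (x ^ 2 + 1) * (x - x ^ 3 / 6) := by
    have : (x ^ 2 + 1) * (x - x ^ 3 / 6) - x = x * x ^ 2 * (5 / 6 - x ^ 2 / 6) := by ring
    have : 0 ≤ x * x ^ 2 * (5 / 6 - x ^ 2 / 6) := by
      refine mul_nonneg (by positivity) (by linarith)
    linarith
  linarith

/-- Quantitative conditions on an even cluster function with `∫ T = 1` and
`∫ T(v) log |v| dv = L`. -/
structure IsClusterProfile (T : ℝ → ℝ) (L : ℝ) : Prop where
  continuous : Continuous T
  even : ∀ v, T (-v) = T v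
  bounded : ∃ C, ∀ v, |T v| ≤ C
  tail : ∃ C, ∀ v, 0 < v → |(∫ u in (0 : ℝ)..v, T u) - 1 / 2| ≤ C / v
  log_limit : Tendsto (fun R => ∫ v in (0 : ℝ)..R, T v * Real.log v) atTop (𝓝 (L / 2))

/-- The primitive of `T(v) log |2 sin (π v / N)|` that vanishes at the origin. -/
def logSinPrimitive (T : ℝ → ℝ) (N y : ℝ) : ℝ :=
  ∫ v in (0 : ℝ)..y, T v * Real.log |2 * Real.sin (Real.pi * v / N)|

lemma tendsto_natCast_rpow_quarter :
    Tendsto (fun N : ℕ => (N : ℝ) ^ (1 / 4 : ℝ)) atTop atTop :=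
  (tendsto_rpow_atTop (by norm_num)).comp tendsto_natCast_atTop_atTop

lemma tendsto_log_div_rpow_quarter :
    Tendsto (fun N : ℕ => Real.log N / (N : ℝ) ^ (1 / 4 : ℝ)) atTop (𝓝 0) :=
  ((isLittleO_log_rpow_atTop (show (0 : ℝ) < 1 / 4 by norm_num)).tendsto_div_nhds_zero).comp
    tendsto_natCast_atTop_atTop

lemma tendsto_natCast_rpow_neg {r : ℝ} (hr : 0 < r) :
    Tendsto (fun N : ℕ => (N : ℝ) ^ (-r)) atTop (𝓝 0) :=
  (tendsto_rpow_neg_atTop hr).comp tendsto_natCast_atTop_atTop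

lemma isLittleO_natCast_rpow {a b : ℝ} (hab : a < b) :
    (fun N : ℕ => (N : ℝ) ^ a) =o[atTop] fun N : ℕ => (N : ℝ) ^ b := by
  rw [isLittleO_iff_tendsto']
  · refine (tendsto_natCast_rpow_neg (sub_pos.2 hab)).congr' ?_
    filter_upwards [eventually_ge_atTop 1] with N hN
    have hN0 : (0 : ℝ) < N := by exact_mod_cast hN
    rw [← Real.rpow_sub hN0, neg_sub]
  · filter_upwards [eventually_ge_atTop 1] with N hN h0
    have hN0 : (0 : ℝ) < N := by exact_mod_cast hN
    exact absurd h0 (Real.rpow_pos_of_pos hN0 b).ne'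

lemma eventually_rpow_quarter_le {c : ℝ} (hc : 0 < c) :
    ∀ᶠ N : ℕ in atTop, (N : ℝ) ^ (1 / 4 : ℝ) ≤ c * N := by
  filter_upwards [(isLittleO_natCast_rpow (show (1 / 4 : ℝ) < 1 by norm_num)).def hc] with N hN
  simpa [abs_of_nonneg (Real.rpow_nonneg (Nat.cast_nonneg N) _)] using hN

/-! ### Log-sine averages of a cluster profile -/

namespace IsClusterProfile

variable {T : ℝ → ℝ} {L : ℝ}

lemma tendsto_integral (h : IsClusterProfile T L) :
    Tendsto (fun R => ∫ v in (0 : ℝ)..R, T v) atTop (𝓝 (1 / 2)) := by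
  obtain ⟨C, hC⟩ := h.tail
  rw [tendsto_iff_norm_sub_tendsto_zero]
  refine squeeze_zero' (Eventually.of_forall fun _ => norm_nonneg _) ?_
    (tendsto_const_nhds.div_atTop tendsto_id : Tendsto (fun v : ℝ => C / v) atTop (𝓝 0))
  filter_upwards [eventually_gt_atTop 0] with v hv using hC v hv

lemma hasImproperIntegral (h : IsClusterProfile T L) : HasImproperIntegral T 1 := by
  have := hasImproperIntegral_of_even h.even (fun a b => h.continuous.intervalIntegrable a b)
    h.tendsto_integral
  norm_num at this
  exact this

lemma hasImproperIntegral_log (h : IsClusterProfile T L) :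
    HasImproperIntegral (fun v => T v * Real.log |v|) L := by
  simp only [Real.log_abs]
  have := hasImproperIntegral_of_even (g := fun v => T v * Real.log v)
    (fun v => by simp only [h.even, Real.log_neg_eq_log])
    (fun a b => intervalIntegral.intervalIntegrable_log'.continuousOn_mul
      h.continuous.continuousOn) h.log_limit
  rwa [mul_div_cancel₀ L two_ne_zero] at this

lemma exists_scale (h : IsClusterProfile T L) : ∃ α : ℕ → ℝ,
    (∀ N, 1 ≤ N → 0 < α N) ∧
    (fun N : ℕ => Real.log N) =o[atTop] α ∧
    (∃ ε : ℝ, 0 < ε ∧ α =o[atTop] fun N : ℕ => (N : ℝ) ^ (1 / 2 - ε)) ∧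
    (∀ δ : ℝ, 0 < δ → ∀ᶠ N : ℕ in atTop, ∀ A ∈ Icc (α N) (N - α N),
      |(∫ v in (α N)..A, T v * Real.log |2 * Real.sin (Real.pi * v / N)|)| < δ) ∧
    (fun N : ℕ => 1 - ∫ v in (-α N)..(α N), T v) =o[atTop] fun N : ℕ => (Real.log N)⁻¹ := by
  obtain ⟨C, hC⟩ := h.tail
  -- Any exponent strictly between `0` and `1/2` would do; with `1/4` and `ε = 1/8` the comparison
  -- is `1/4 < 3/8`.
  refine ⟨fun N => (N : ℝ) ^ (1 / 4 : ℝ), ?_, ?_, ⟨1 / 8, by norm_num, ?_⟩, ?_, ?_⟩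
  · intro N hN
    have : (0 : ℝ) < N := by exact_mod_cast hN
    positivity
  · exact (isLittleO_log_rpow_atTop (by norm_num)).comp_tendsto tendsto_natCast_atTop_atTop
  · exact isLittleO_natCast_rpow (by norm_num)
  · intro δ hδ
    have t := tendsto_log_div_rpow_quarter.const_mul (8 * C)
    rw [mul_zero] at t
    filter_upwards [t.eventually (gt_mem_nhds hδ),
      tendsto_natCast_rpow_quarter.eventually_ge_atTop 1] with N h1 h2 A hA
    exact (abs_integral_mul_log_two_sin_le h.continuous hC h2 hA.1 hA.2).trans_lt h1
  · rw [isLittleO_iff_tendsto']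
    · have t := tendsto_log_div_rpow_quarter.const_mul (2 * C)
      rw [mul_zero] at t
      refine squeeze_zero_norm' ?_ t
      filter_upwards [tendsto_natCast_rpow_quarter.eventually_ge_atTop 1,
        eventually_ge_atTop 1] with N h2 hN
      set α := (N : ℝ) ^ (1 / 4 : ℝ)
      have hl : 0 ≤ Real.log N := Real.log_nonneg (by exact_mod_cast hN)
      have e : ∫ v in (-α)..α, T v = 2 * ∫ v in (0 : ℝ)..α, T v := by
        rw [← intervalIntegral.integral_interval_sub_left (h.continuous.intervalIntegrable 0 α)
          (h.continuous.intervalIntegrable 0 (-α)), integral_zero_neg_of_even h.even]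
        ring
      have hb := hC α (by linarith)
      rw [e, div_inv_eq_mul, norm_mul, Real.norm_eq_abs, Real.norm_of_nonneg hl]
      have : |1 - 2 * ∫ v in (0 : ℝ)..α, T v| ≤ 2 * (C / α) := by
        have e2 : 1 - 2 * ∫ v in (0 : ℝ)..α, T v
            = -(2 * ((∫ v in (0 : ℝ)..α, T v) - 1 / 2)) := by ring
        rw [e2, abs_neg, abs_mul, abs_two]
        gcongr
      calc _ ≤ 2 * (C / α) * Real.log N := by gcongr
        _ = _ := by ring
    · filter_upwards [eventually_ge_atTop 2] with N hN h0
      have : 0 < Real.log N := Real.log_pos (by exact_mod_cast hN)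
      simp [this.ne'] at h0

lemma continuous_logSinPrimitive (h : IsClusterProfile T L) (N : ℝ) :
    Continuous (logSinPrimitive T N) :=
  intervalIntegral.continuous_primitive
    (fun a b => intervalIntegrable_mul_log_two_sin h.continuous a b) 0

lemma _root_.abs_integral_mul_le_of_abs_le {T f : ℝ → ℝ} {C a b : ℝ} (hC : ∀ v, |T v| ≤ C)
    (hab : a ≤ b) (hi : IntervalIntegrable f volume a b) :
    |(∫ v in a..b, T v * f v)| ≤ C * ∫ v in a..b, |f v| := by
  rw [← Real.norm_eq_abs, ← intervalIntegral.integral_const_mul]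
  refine intervalIntegral.norm_integral_le_of_norm_le hab (ae_of_all _ fun v _ => ?_)
    (hi.norm.const_mul C)
  rw [norm_mul]
  exact mul_le_mul_of_nonneg_right (hC v) (norm_nonneg _)

lemma abs_logSinPrimitive_sub_le (h : IsClusterProfile T L) {C : ℝ}
    (hC : ∀ v, |T v| ≤ C) {N a b a' b' : ℝ} (haa : a' ≤ a) (hab : a ≤ b) (hbb : b ≤ b') :
    |logSinPrimitive T N b - logSinPrimitive T N a|
      ≤ C * ∫ v in a'..b', |(Real.log |2 * Real.sin (Real.pi * v / N)|)| := by
  have hC0 : 0 ≤ C := (abs_nonneg _).trans (hC 0)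
  have hi := fun a b => intervalIntegrable_mul_log_two_sin h.continuous (N := N) a b
  rw [logSinPrimitive, logSinPrimitive, intervalIntegral.integral_interval_sub_left
    (hi 0 b) (hi 0 a)]
  refine (abs_integral_mul_le_of_abs_le hC hab (intervalIntegrable_log_two_sin a b)).trans ?_
  gcongr
  exact intervalIntegral.integral_mono_interval haa hab hbb
    (ae_of_all _ fun v => abs_nonneg _) (intervalIntegrable_log_two_sin a' b').norm

lemma integral_abs_log_two_sin_reflect (N α : ℝ) (hN : 0 < N) :
    ∫ v in (N - α)..N, |(Real.log |2 * Real.sin (Real.pi * v / N)|)|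
      = ∫ v in (0 : ℝ)..α, |(Real.log |2 * Real.sin (Real.pi * v / N)|)| := by
  have h := intervalIntegral.integral_comp_sub_left (a := 0) (b := α)
    (fun v => |(Real.log |2 * Real.sin (Real.pi * v / N)|)|) N
  rw [sub_zero] at h
  rw [← h]
  refine intervalIntegral.integral_congr fun v _ => ?_
  have e : Real.pi * (N - v) / N = Real.pi - Real.pi * v / N := by field_simp
  simp only [e, Real.sin_pi_sub]

/-- The average of the primitive over the window is close to its value at `α`. -/
lemma abs_average_logSinPrimitive_sub_le (h : IsClusterProfile T L) {C C' : ℝ}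
    (hC : ∀ v, |T v| ≤ C)
    (hC' : ∀ v, 0 < v → |(∫ u in (0 : ℝ)..v, T u) - 1 / 2| ≤ C' / v)
    {N α : ℝ} (hα : 1 ≤ α) (hN : α ≤ N / 2) :
    |2 / N * (∫ y in (0 : ℝ)..N, logSinPrimitive T N y) - 2 * logSinPrimitive T N α|
      ≤ 16 * C' * (Real.log N / α) + 12 * C * (α * √(N * α) / N) := by
  have hN0 : 0 < N := by linarith
  have hC0 : 0 ≤ C := (abs_nonneg _).trans (hC 0)
  have hC0' : 0 ≤ C' := by
    have := (abs_nonneg _).trans (hC' 1 one_pos); simpa using this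
  have hlog : 0 ≤ Real.log N := Real.log_nonneg (by linarith)
  set G := logSinPrimitive T N with hG
  have hGc : Continuous G := h.continuous_logSinPrimitive N
  set δ := 8 * C' * (Real.log N / α) with hδ
  set E := C * (3 * √(N * α)) with hE
  have hδ0 : 0 ≤ δ := by positivity
  have hE0 : 0 ≤ E := by positivity
  have hI := integral_abs_log_two_sin_le (N := N) (α := α) (by linarith) hN
  have mid : ∀ y, α ≤ y → y ≤ N - α → |G y - G α| ≤ δ := by
    intro y h0 h1
    have hi := fun a b => intervalIntegrable_mul_log_two_sin h.continuous (N := N) a b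
    rw [hG, logSinPrimitive, logSinPrimitive, intervalIntegral.integral_interval_sub_left
      (hi 0 y) (hi 0 α)]
    exact abs_integral_mul_log_two_sin_le h.continuous hC' hα h0 h1
  have low : ∀ y, 0 ≤ y → y ≤ α → |G y - G α| ≤ E := by
    intro y h0 h1
    rw [abs_sub_comm]
    exact (h.abs_logSinPrimitive_sub_le hC h0 h1 le_rfl).trans (mul_le_mul_of_nonneg_left hI hC0)
  -- By reflection the right edge costs as much as the left one; from `N - α` the middle estimate
  -- leads back to `α`.
  have high : ∀ y, N - α ≤ y → y ≤ N → |G y - G α| ≤ E + δ := by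
    intro y h0 h1
    have a1 : |G y - G (N - α)| ≤ E := by
      refine (h.abs_logSinPrimitive_sub_le hC le_rfl h0 h1).trans ?_
      rw [integral_abs_log_two_sin_reflect N α hN0]
      exact mul_le_mul_of_nonneg_left hI hC0
    have a2 := mid (N - α) (by linarith) le_rfl
    have := abs_sub_le (G y) (G (N - α)) (G α)
    linarith
  have hi : ∀ a b, IntervalIntegrable (fun y => G y - G α) volume a b := fun a b =>
    (hGc.sub continuous_const).intervalIntegrable a b
  have split : ∫ y in (0 : ℝ)..N, (G y - G α) = (∫ y in (0 : ℝ)..α, (G y - G α))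
      + (∫ y in α..(N - α), (G y - G α)) + ∫ y in (N - α)..N, (G y - G α) := by
    rw [intervalIntegral.integral_add_adjacent_intervals (hi _ _) (hi _ _),
      intervalIntegral.integral_add_adjacent_intervals (hi _ _) (hi _ _)]
  have n1 : |∫ y in (0 : ℝ)..α, (G y - G α)| ≤ E * α := by
    have := intervalIntegral.norm_integral_le_of_norm_le_const (a := 0) (b := α) (C := E)
      (f := fun y => G y - G α) fun y hy => by
        rw [uIoc_of_le (by linarith)] at hy
        exact low y hy.1.le hy.2
    rwa [sub_zero, abs_of_nonneg (by linarith : 0 ≤ α)] at this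
  have n2 : |∫ y in α..(N - α), (G y - G α)| ≤ δ * (N - α - α) := by
    have := intervalIntegral.norm_integral_le_of_norm_le_const (a := α) (b := N - α) (C := δ)
      (f := fun y => G y - G α) fun y hy => by
        rw [uIoc_of_le (by linarith)] at hy
        exact mid y hy.1.le hy.2
    rwa [abs_of_nonneg (by linarith : 0 ≤ N - α - α)] at this
  have n3 : |∫ y in (N - α)..N, (G y - G α)| ≤ (E + δ) * α := by
    have := intervalIntegral.norm_integral_le_of_norm_le_const (a := N - α) (b := N) (C := E + δ)
      (f := fun y => G y - G α) fun y hy => by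
        rw [uIoc_of_le (by linarith)] at hy
        exact high y hy.1.le hy.2
    rwa [sub_sub_cancel, abs_of_nonneg (by linarith : 0 ≤ α)] at this
  have tot : |∫ y in (0 : ℝ)..N, (G y - G α)| ≤ δ * N + 2 * E * α := by
    rw [split]
    refine (abs_add_three _ _ _).trans ?_
    nlinarith
  have e : 2 / N * (∫ y in (0 : ℝ)..N, G y) - 2 * G α
      = 2 / N * ∫ y in (0 : ℝ)..N, (G y - G α) := by
    rw [intervalIntegral.integral_sub (hGc.intervalIntegrable _ _) intervalIntegrable_const,
      intervalIntegral.integral_const]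
    simp only [sub_zero, smul_eq_mul]
    field_simp
  rw [e, abs_mul, abs_of_pos (by positivity : 0 < 2 / N)]
  calc 2 / N * |∫ y in (0 : ℝ)..N, (G y - G α)| ≤ 2 / N * (δ * N + 2 * E * α) := by gcongr
    _ = _ := by rw [hδ, hE]; field_simp; ring

/-- The primitive at a small scale `α`, up to the error of replacing `2 sin` by its argument. -/
lemma abs_logSinPrimitive_sub_main_le (h : IsClusterProfile T L) {C : ℝ}
    (hC : ∀ v, |T v| ≤ C) {N α : ℝ} (hα : 0 < α) (hN : 4 * α ≤ N) :
    |logSinPrimitive T N α - ((∫ v in (0 : ℝ)..α, T v * Real.log v)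
      + (Real.log (2 * Real.pi) - Real.log N) * ∫ v in (0 : ℝ)..α, T v)|
      ≤ C * (4 * α / N) ^ 2 * α := by
  have hN0 : 0 < N := by linarith
  have hC0 : 0 ≤ C := (abs_nonneg _).trans (hC 0)
  have i1 := intervalIntegrable_mul_log_two_sin h.continuous (N := N) 0 α
  have i2 : IntervalIntegrable (fun v => T v * Real.log v) volume 0 α :=
    intervalIntegral.intervalIntegrable_log'.continuousOn_mul h.continuous.continuousOn
  have i3 := (h.continuous.intervalIntegrable (μ := volume) 0 α).const_mul
    (Real.log (2 * Real.pi) - Real.log N)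
  rw [logSinPrimitive, ← intervalIntegral.integral_const_mul,
    ← intervalIntegral.integral_add i2 i3, ← intervalIntegral.integral_sub i1 (i2.add i3)]
  have := intervalIntegral.norm_integral_le_of_norm_le_const (a := 0) (b := α)
    (C := C * (4 * α / N) ^ 2)
    (f := fun v => T v * Real.log |2 * Real.sin (Real.pi * v / N)| -
      (T v * Real.log v + (Real.log (2 * Real.pi) - Real.log N) * T v)) fun v hv => by
    rw [uIoc_of_le hα.le] at hv
    obtain ⟨h0, h1⟩ := hv
    have hx0 : 0 < Real.pi * v / N := by positivity
    -- Bounding `π` by `4` explains the hypothesis `4 α ≤ N`: it keeps the argument of the sine at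
    -- most `1`.
    have hx2 : Real.pi * v / N ≤ 4 * α / N := by
      gcongr; exact Real.pi_le_four
    have hx1 : Real.pi * v / N ≤ 1 := hx2.trans (by rw [div_le_one hN0]; exact hN)
    have hs : 0 < Real.sin (Real.pi * v / N) :=
      Real.sin_pos_of_pos_of_lt_pi hx0 (by linarith [Real.pi_gt_three])
    have e : T v * Real.log |2 * Real.sin (Real.pi * v / N)| -
        (T v * Real.log v + (Real.log (2 * Real.pi) - Real.log N) * T v)
        = T v * (Real.log (Real.sin (Real.pi * v / N)) - Real.log (Real.pi * v / N)) := by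
      rw [Real.log_abs, Real.log_mul two_ne_zero hs.ne', Real.log_mul two_ne_zero Real.pi_ne_zero,
        Real.log_div (by positivity) hN0.ne', Real.log_mul Real.pi_ne_zero h0.ne']
      ring
    rw [e, norm_mul]
    refine mul_le_mul (hC v) ((abs_log_sin_sub_log_le hx0 hx1).trans ?_) (norm_nonneg _) hC0
    gcongr
  rwa [sub_zero, abs_of_pos hα] at this

/-- The limit of the truncated log-sine averages. -/
theorem tendsto_log_add_average (h : IsClusterProfile T L) :
    Tendsto (fun N : ℕ => Real.log N
      + 2 / N * ∫ y in (0 : ℝ)..N, logSinPrimitive T N y) atTop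
      (𝓝 (L + Real.log (2 * Real.pi))) := by
  obtain ⟨C, hC⟩ := h.bounded
  obtain ⟨C', hC'⟩ := h.tail
  set α : ℕ → ℝ := fun N => (N : ℝ) ^ (1 / 4 : ℝ) with hα
  have hαt : Tendsto α atTop atTop := tendsto_natCast_rpow_quarter
  have t1 : Tendsto (fun N : ℕ => 2 / (N : ℝ) * (∫ y in (0 : ℝ)..N, logSinPrimitive T N y)
      - 2 * logSinPrimitive T N (α N)) atTop (𝓝 0) := by
    have b1 := tendsto_log_div_rpow_quarter.const_mul (16 * C')
    -- The edge error `α √(N α) / N` equals `N^(-1/8)` at `α = N^(1/4)`.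
    have b2 := (tendsto_natCast_rpow_neg (show (0 : ℝ) < 1 / 8 by norm_num)).const_mul (12 * C)
    have b3 := b1.add b2
    rw [mul_zero, mul_zero, add_zero] at b3
    refine squeeze_zero_norm' ?_ b3
    filter_upwards [hαt.eventually_ge_atTop 1,
      eventually_rpow_quarter_le (show (0 : ℝ) < 1 / 2 by norm_num),
      eventually_ge_atTop 1] with N h1 h2 hN
    have hN0 : (0 : ℝ) < N := by exact_mod_cast hN
    refine (h.abs_average_logSinPrimitive_sub_le hC hC' h1 (by linarith)).trans (le_of_eq ?_)
    congr 2
    rw [hα, Real.sqrt_eq_rpow, Real.mul_rpow hN0.le (by positivity), ← Real.rpow_mul hN0.le,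
      ← Real.rpow_add hN0, ← Real.rpow_add hN0, ← Real.rpow_sub_one hN0.ne']
    norm_num
  have t2 : Tendsto (fun N : ℕ => logSinPrimitive T N (α N)
      - ((∫ v in (0 : ℝ)..(α N), T v * Real.log v)
      + (Real.log (2 * Real.pi) - Real.log N) * ∫ v in (0 : ℝ)..(α N), T v)) atTop (𝓝 0) := by
    have b := (tendsto_natCast_rpow_neg (show (0 : ℝ) < 5 / 4 by norm_num)).const_mul (16 * C)
    rw [mul_zero] at b
    refine squeeze_zero_norm' ?_ b
    filter_upwards [hαt.eventually_ge_atTop 1,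
      eventually_rpow_quarter_le (show (0 : ℝ) < 1 / 4 by norm_num),
      eventually_ge_atTop 1] with N h1 h2 hN
    have hN0 : (0 : ℝ) < N := by exact_mod_cast hN
    refine (h.abs_logSinPrimitive_sub_main_le hC (by linarith) (by
      have : α N ≤ 1 / 4 * N := h2
      linarith)).trans (le_of_eq ?_)
    have e : (N : ℝ) ^ (-(5 / 4) : ℝ) = α N ^ 3 / N ^ 2 := by
      rw [hα, ← Real.rpow_natCast _ 3, ← Real.rpow_mul hN0.le, ← Real.rpow_natCast _ 2,
        ← Real.rpow_sub hN0]
      norm_num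
    rw [e]
    field_simp
    ring
  -- The cancellation of `log N`: the mass `2 ∫_0^α T` must reach `1` faster than `1 / log N`, and
  -- it does so at rate `1/α`.
  have t3 : Tendsto (fun N : ℕ => Real.log N * (1 - 2 * ∫ v in (0 : ℝ)..(α N), T v)) atTop
      (𝓝 0) := by
    have b := tendsto_log_div_rpow_quarter.const_mul (2 * C')
    rw [mul_zero] at b
    refine squeeze_zero_norm' ?_ b
    filter_upwards [hαt.eventually_ge_atTop 1, eventually_ge_atTop 1] with N h1 hN
    have hl : 0 ≤ Real.log N := Real.log_nonneg (by exact_mod_cast hN)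
    have hb := hC' (α N) (by linarith)
    have e2 : 1 - 2 * ∫ v in (0 : ℝ)..(α N), T v
        = -(2 * ((∫ v in (0 : ℝ)..(α N), T v) - 1 / 2)) := by ring
    rw [e2, norm_mul, Real.norm_of_nonneg hl, Real.norm_eq_abs, abs_neg, abs_mul, abs_two]
    calc _ ≤ Real.log N * (2 * (C' / α N)) := by gcongr
      _ = _ := by ring
  have t4 := (h.log_limit.comp hαt).const_mul 2
  have t5 := (h.tendsto_integral.comp hαt).const_mul (2 * Real.log (2 * Real.pi))
  have key := (((t1.add (t2.const_mul 2)).add t3).add t4).add t5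
  have e : (0 + 2 * 0 + 0 + 2 * (L / 2) + 2 * Real.log (2 * Real.pi) * (1 / 2) : ℝ)
      = L + Real.log (2 * Real.pi) := by ring
  rw [e] at key
  refine key.congr fun N => ?_
  simp only [Function.comp]
  ring

end IsClusterProfile

/-! ### Double integrals of functions of the difference -/

/-- The shear `(x, y) ↦ (x - y, y)` preserves area and maps the square into `[-N, N] × [0, N]`,
where the integrand is a product. -/
lemma integrableOn_square_comp_sub {g : ℝ → ℝ} (hi : ∀ a b, IntervalIntegrable g volume a b)
    (N : ℝ) :
    IntegrableOn (fun p : ℝ × ℝ => g (p.1 - p.2)) (Icc 0 N ×ˢ Icc 0 N) := by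
  rcases lt_or_ge N 0 with hN | hN
  · simp [Icc_eq_empty_of_lt hN]
  have h1 : Integrable ((Icc (-N) N).indicator g) := by
    rw [integrable_indicator_iff measurableSet_Icc, integrableOn_Icc_iff_integrableOn_Ioc]
    exact (intervalIntegrable_iff_integrableOn_Ioc_of_le (by linarith)).1 (hi _ _)
  have h2 : Integrable ((Icc 0 N).indicator fun _ : ℝ => (1 : ℝ)) := by
    rw [integrable_indicator_iff measurableSet_Icc]
    exact integrableOn_const (by simp)
  have h3 := (measurePreserving_sub_prod (volume : Measure ℝ) (volume : Measure ℝ)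
    ).integrable_comp_of_integrable (Integrable.mul_prod h1 h2)
  refine IntegrableOn.congr_fun h3.integrableOn ?_ (measurableSet_Icc.prod measurableSet_Icc)
  rintro ⟨x, y⟩ ⟨hx, hy⟩
  have hxy : x - y ∈ Icc (-N) N := ⟨by linarith [hx.1, hy.2], by linarith [hx.2, hy.1]⟩
  have hy' : y ∈ Icc 0 N := hy
  simp [Function.comp, indicator_of_mem hxy, indicator_of_mem hy']

lemma setIntegral_square_comp_sub {g : ℝ → ℝ} (he : ∀ v, g (-v) = g v)
    (hi : ∀ a b, IntervalIntegrable g volume a b) {N : ℝ} (hN : 0 ≤ N) :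
    ∫ p in (Icc 0 N ×ˢ Icc 0 N : Set (ℝ × ℝ)), g (p.1 - p.2)
      = ∫ x in (0 : ℝ)..N, ((∫ v in (0 : ℝ)..x, g v) + ∫ v in (0 : ℝ)..(N - x), g v) := by
  rw [Measure.volume_eq_prod, setIntegral_prod _ (integrableOn_square_comp_sub hi N),
    intervalIntegral.integral_of_le hN, integral_Icc_eq_integral_Ioc]
  refine setIntegral_congr_fun measurableSet_Ioc fun x _ => ?_
  simp only
  rw [integral_Icc_eq_integral_Ioc, ← intervalIntegral.integral_of_le hN,
    intervalIntegral.integral_comp_sub_left g x, sub_zero,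
    ← intervalIntegral.integral_interval_sub_left (hi 0 x) (hi 0 (x - N)),
    ← neg_sub N x, integral_zero_neg_of_even he]
  ring

lemma log_two_sin_neg (N v : ℝ) : Real.log |2 * Real.sin (Real.pi * (-v) / N)|
    = Real.log |2 * Real.sin (Real.pi * v / N)| := by
  rw [mul_neg, neg_div, Real.sin_neg, mul_neg, abs_neg]

/-- The classical `∫_0^π log sin = -π log 2`; the factor `2` in the energy is exactly what makes the
mean vanish. -/
lemma integral_log_two_sin {N : ℝ} (hN : 0 < N) :
    ∫ v in (0 : ℝ)..N, Real.log |2 * Real.sin (Real.pi * v / N)| = 0 := by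
  have h := intervalIntegral.integral_comp_mul_left (a := 0) (b := N)
    (fun x => Real.log |2 * Real.sin x|) (c := Real.pi / N) (by positivity)
  have e : ∀ v : ℝ, Real.pi / N * v = Real.pi * v / N := fun v => by ring
  simp only [e, mul_zero, zero_div] at h
  rw [h, mul_div_assoc, div_self hN.ne', mul_one]
  have h2 : ∫ x in (0 : ℝ)..Real.pi, Real.log |2 * Real.sin x|
      = ∫ x in (0 : ℝ)..Real.pi, (Real.log 2 + Real.log (Real.sin x)) := by
    rw [intervalIntegral.integral_of_le Real.pi_pos.le, intervalIntegral.integral_of_le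
      Real.pi_pos.le, integral_Ioc_eq_integral_Ioo, integral_Ioc_eq_integral_Ioo]
    refine setIntegral_congr_fun measurableSet_Ioo fun x hx => ?_
    have := Real.sin_pos_of_pos_of_lt_pi hx.1 hx.2
    simp only [Real.log_abs]
    rw [Real.log_mul two_ne_zero this.ne']
  have hls : IntervalIntegrable (fun x => Real.log (Real.sin x)) volume 0 Real.pi :=
    intervalIntegrable_log_sin
  rw [h2, intervalIntegral.integral_add intervalIntegrable_const hls,
    integral_log_sin_zero_pi]
  simp
  right; ring

/-- For fixed `x`, the symmetry `v ↦ N - v` turns the two pieces into one integral over a full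
period. Thus the uncorrelated part of the two-point function contributes nothing. -/
lemma setIntegral_square_log_two_sin {N : ℝ} (hN : 0 < N) :
    ∫ p in (Icc 0 N ×ˢ Icc 0 N : Set (ℝ × ℝ)),
      Real.log |2 * Real.sin (Real.pi * (p.1 - p.2) / N)| = 0 := by
  rw [setIntegral_square_comp_sub (g := fun v => Real.log |2 * Real.sin (Real.pi * v / N)|)
    (log_two_sin_neg N) intervalIntegrable_log_two_sin hN.le]
  have : ∀ x : ℝ, (∫ v in (0 : ℝ)..x, Real.log |2 * Real.sin (Real.pi * v / N)|)
      + ∫ v in (0 : ℝ)..(N - x), Real.log |2 * Real.sin (Real.pi * v / N)| = 0 := by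
    intro x
    have h := intervalIntegral.integral_comp_sub_left (a := 0) (b := N - x)
      (fun v => Real.log |2 * Real.sin (Real.pi * v / N)|) N
    have e : ∀ v : ℝ, Real.pi * (N - v) / N = Real.pi - Real.pi * v / N := fun v => by field_simp
    simp only [e, Real.sin_pi_sub, sub_sub_cancel, sub_zero] at h
    rw [h, intervalIntegral.integral_add_adjacent_intervals
      (intervalIntegrable_log_two_sin _ _) (intervalIntegrable_log_two_sin _ _),
      integral_log_two_sin hN]
  simp only [this, intervalIntegral.integral_zero]

lemma IsClusterProfile.setIntegral_square {T : ℝ → ℝ} {L : ℝ} (h : IsClusterProfile T L) {N : ℝ}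
    (hN : 0 < N) :
    IntegrableOn (fun p : ℝ × ℝ => Real.log |2 * Real.sin (Real.pi * (p.1 - p.2) / N)|
      * (1 - T (p.1 - p.2))) (Icc 0 N ×ˢ Icc 0 N) ∧
    ∫ p in (Icc 0 N ×ˢ Icc 0 N : Set (ℝ × ℝ)),
      Real.log |2 * Real.sin (Real.pi * (p.1 - p.2) / N)| * (1 - T (p.1 - p.2))
      = -(2 * ∫ y in (0 : ℝ)..N, logSinPrimitive T N y) := by
  have hi := fun a b => intervalIntegrable_mul_log_two_sin h.continuous (N := N) a b
  have i1 := integrableOn_square_comp_sub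
    (g := fun v => Real.log |2 * Real.sin (Real.pi * v / N)|) intervalIntegrable_log_two_sin N
  have i2 := integrableOn_square_comp_sub
    (g := fun v => T v * Real.log |2 * Real.sin (Real.pi * v / N)|) hi N
  have e : ∀ p : ℝ × ℝ, Real.log |2 * Real.sin (Real.pi * (p.1 - p.2) / N)|
      * (1 - T (p.1 - p.2)) = Real.log |2 * Real.sin (Real.pi * (p.1 - p.2) / N)|
      - T (p.1 - p.2) * Real.log |2 * Real.sin (Real.pi * (p.1 - p.2) / N)| := fun p => by ring
  simp only [e]
  refine ⟨i1.sub i2, ?_⟩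
  rw [integral_sub i1 i2, setIntegral_square_log_two_sin hN, zero_sub,
    setIntegral_square_comp_sub (g := fun v => T v * Real.log |2 * Real.sin (Real.pi * v / N)|)
      (fun v => by simp only [h.even, log_two_sin_neg]) hi hN.le]
  have hc := h.continuous_logSinPrimitive N
  have h1 : ∫ x in (0 : ℝ)..N, (logSinPrimitive T N x + logSinPrimitive T N (N - x))
      = 2 * ∫ y in (0 : ℝ)..N, logSinPrimitive T N y := by
    have hc' : Continuous fun x => logSinPrimitive T N (N - x) := hc.comp (continuous_sub_left N)
    rw [intervalIntegral.integral_add (hc.intervalIntegrable _ _) (hc'.intervalIntegrable _ _),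
      intervalIntegral.integral_comp_sub_left (logSinPrimitive T N) N]
    simp only [sub_self, sub_zero]
    ring
  rw [← h1]
  rfl

/-! ### Sums over pairs of points -/

namespace PointConfiguration

lemma measurable_encard_inter {B : Set ℝ} (hB : MeasurableSet B) :
    Measurable fun ω : PointConfiguration => (ω.points ∩ B).encard :=
  Measurable.mono (comap_measurable _) (le_iSup₂_of_le B hB le_rfl) le_rfl

lemma mem_window {ω : PointConfiguration} {N : ℕ} {x : ℝ} :
    x ∈ ω.window N ↔ x ∈ ω.points ∧ x ∈ Icc 0 (N : ℝ) := by
  simp [window]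

lemma sum_indicator_window (ω : PointConfiguration) (N : ℕ) (A : Set ℝ) :
    ∑ x ∈ ω.window N, A.indicator (1 : ℝ → ENNReal) x
      = ((ω.points ∩ (Icc 0 (N : ℝ) ∩ A)).encard : ENNReal) := by
  classical
  have e : ω.points ∩ (Icc 0 (N : ℝ) ∩ A) = ((ω.window N).filter (· ∈ A) : Finset ℝ) := by
    ext x; simp only [Finset.coe_filter, mem_window, mem_inter_iff, mem_ofPred_eq, and_assoc]
  rw [e, Set.encard_coe_eq_coe_finsetCard]
  simp [Set.indicator_apply, Finset.sum_boole]

/-- The counting measure on the ordered pairs of points in the window. -/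
def pairMeasure (N : ℕ) (ω : PointConfiguration) : Measure (ℝ × ℝ) :=
  ∑ p ∈ ω.window N ×ˢ ω.window N, Measure.dirac p

instance (N : ℕ) (ω : PointConfiguration) : IsFiniteMeasure (pairMeasure N ω) := by
  unfold pairMeasure; infer_instance

lemma pairMeasure_prod (N : ℕ) (ω : PointConfiguration) {A B : Set ℝ} (hA : MeasurableSet A)
    (hB : MeasurableSet B) : pairMeasure N ω (A ×ˢ B)
      = ((ω.points ∩ (Icc 0 (N : ℝ) ∩ A)).encard : ENNReal)
        * ((ω.points ∩ (Icc 0 (N : ℝ) ∩ B)).encard : ENNReal) := by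
  rw [← sum_indicator_window, ← sum_indicator_window, pairMeasure, Measure.finsetSum_apply,
    Finset.sum_mul_sum, Finset.sum_product]
  refine Finset.sum_congr rfl fun x _ => Finset.sum_congr rfl fun y _ => ?_
  rw [Measure.dirac_apply' _ (hA.prod hB)]
  by_cases hx : x ∈ A <;> by_cases hy : y ∈ B <;> simp [hx, hy]

/-- On a rectangle the pair measure is a product of two counts, measurable by the choice of the
σ-algebra; rectangles form a generating π-system. -/
lemma measurable_pairMeasure (N : ℕ) : Measurable (pairMeasure N) := by
  have hrect : ∀ A B : Set ℝ, MeasurableSet A → MeasurableSet B →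
      Measurable fun ω => pairMeasure N ω (A ×ˢ B) := by
    intro A B hA hB
    simp only [pairMeasure_prod N _ hA hB]
    have m : Measurable fun n : ℕ∞ => (n : ENNReal) := by fun_prop
    exact (m.comp (measurable_encard_inter (measurableSet_Icc.inter hA))).mul
      (m.comp (measurable_encard_inter (measurableSet_Icc.inter hB)))
  refine Measurable.measure_of_isPiSystem generateFrom_prod.symm isPiSystem_prod ?_ ?_
  · rintro _ ⟨A, hA, B, hB, rfl⟩
    exact hrect A B hA hB
  · simpa using hrect univ univ .univ .univ

/-- The sum is the integral of `g`, cut off to the complement of the diagonal, against a measurable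
family of measures. -/
lemma measurable_sum_offDiag (N : ℕ) {g : ℝ × ℝ → ENNReal} (hg : Measurable g) :
    Measurable fun ω : PointConfiguration => ∑ p ∈ (ω.window N).offDiag, g p := by
  have hD : MeasurableSet {p : ℝ × ℝ | p.1 ≠ p.2} :=
    (measurableSet_eq_fun measurable_fst measurable_snd).compl
  have h := (Measure.measurable_lintegral (hg.indicator hD)).comp (measurable_pairMeasure N)
  convert! h using 1
  funext ω
  simp only [Function.comp, pairMeasure, lintegral_finsetSum_measure]
  have : (ω.window N).offDiag = (ω.window N ×ˢ ω.window N).filter fun p => p.1 ≠ p.2 := by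
    ext p; simp [Finset.mem_offDiag, and_assoc]
  rw [this, Finset.sum_filter]
  refine Finset.sum_congr rfl fun p _ => ?_
  rw [lintegral_dirac' _ (hg.indicator hD)]
  simp [Set.indicator_apply]

lemma tsum_pairs_eq_sum_offDiag (N : ℕ) (ω : PointConfiguration) (g : ℝ × ℝ → ENNReal) :
    ∑' x : {x : Fin 2 → ℝ // Function.Injective x ∧ ∀ i, x i ∈ ω.points},
      (Icc 0 (N : ℝ) ×ˢ Icc 0 (N : ℝ)).indicator g (x.1 0, x.1 1)
      = ∑ p ∈ (ω.window N).offDiag, g p := by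
  have h1 := tsum_subtype {x : Fin 2 → ℝ | Function.Injective x ∧ ∀ i, x i ∈ ω.points}
    (fun x => (Icc 0 (N : ℝ) ×ˢ Icc 0 (N : ℝ)).indicator g (x 0, x 1))
  refine h1.trans ?_
  rw [← (finTwoArrowEquiv ℝ).symm.tsum_eq, tsum_eq_sum (s := (ω.window N).offDiag)]
  · refine Finset.sum_congr rfl fun p hp => ?_
    rw [Finset.mem_offDiag, mem_window, mem_window] at hp
    obtain ⟨⟨h1, h2⟩, ⟨h3, h4⟩, h5⟩ := hp
    rw [indicator_of_mem, indicator_of_mem]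
    · simp
    · simp only [finTwoArrowEquiv_symm_apply, Matrix.cons_val_zero, Matrix.cons_val_one]
      exact ⟨h2, h4⟩
    · refine ⟨?_, ?_⟩
      · intro i j hij
        fin_cases i <;> fin_cases j <;> simp_all [finTwoArrowEquiv]
      · intro i
        fin_cases i
        · exact h1
        · exact h3
  · intro p hp
    by_contra hne
    apply hp
    have m1 := mem_of_indicator_ne_zero hne
    rw [indicator_of_mem m1] at hne
    have m2 := mem_of_indicator_ne_zero hne
    obtain ⟨hinj, hmem⟩ := m1
    rw [Finset.mem_offDiag, mem_window, mem_window]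
    refine ⟨⟨hmem 0, m2.1⟩, ⟨hmem 1, m2.2⟩, fun h => ?_⟩
    have : (0 : Fin 2) = 1 := hinj h
    exact absurd this (by decide)

/-- Campbell's formula for the pairs of points in the window. -/
lemma lintegral_sum_offDiag {P : Measure PointConfiguration} {r : ℝ × ℝ → ℝ}
    (hP : IsCorrelationFunction P 2 fun x => r (x 0, x 1)) (N : ℕ) {g : ℝ × ℝ → ENNReal}
    (hg : Measurable g) :
    ∫⁻ ω, ∑ p ∈ (ω.window N).offDiag, g p ∂P
      = ∫⁻ p in Icc 0 (N : ℝ) ×ˢ Icc 0 (N : ℝ), g p * ENNReal.ofReal (r p) := by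
  have hm : MeasurableSet (Icc 0 (N : ℝ) ×ˢ Icc 0 (N : ℝ)) :=
    measurableSet_Icc.prod measurableSet_Icc
  have h := hP.2.2 (fun x => (Icc 0 (N : ℝ) ×ˢ Icc 0 (N : ℝ)).indicator g (x 0, x 1))
    ((hg.indicator hm).comp ((measurable_pi_apply 0).prodMk (measurable_pi_apply 1)))
  simp only [tsum_pairs_eq_sum_offDiag] at h
  rw [h, ← lintegral_indicator hm]
  rw [← (volume_preserving_finTwoArrow ℝ).lintegral_comp_emb
    MeasurableEquiv.finTwoArrow.measurableEmbedding]
  refine lintegral_congr fun x => ?_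
  have e : MeasurableEquiv.finTwoArrow x = (x 0, x 1) := rfl
  rw [e]
  by_cases hx : (x 0, x 1) ∈ Icc 0 (N : ℝ) ×ˢ Icc 0 (N : ℝ)
  · rw [indicator_of_mem hx, indicator_of_mem hx]
  · rw [indicator_of_notMem hx, indicator_of_notMem hx, zero_mul]

/-- Campbell's formula is available for nonnegative functions only, so it is applied to the positive
and negative parts of `f`; both are finite by `hi`. -/
lemma integral_sum_offDiag {P : Measure PointConfiguration} {r : ℝ × ℝ → ℝ}
    (hP : IsCorrelationFunction P 2 fun x => r (x 0, x 1)) (N : ℕ) {f : ℝ × ℝ → ℝ}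
    (hf : Measurable f)
    (hi : IntegrableOn (fun p => f p * r p) (Icc 0 (N : ℝ) ×ˢ Icc 0 (N : ℝ))) :
    Integrable (fun ω : PointConfiguration => ∑ p ∈ (ω.window N).offDiag, f p) P ∧
    ∫ ω, ∑ p ∈ (ω.window N).offDiag, f p ∂P
      = ∫ p in Icc 0 (N : ℝ) ×ˢ Icc 0 (N : ℝ), f p * r p := by
  have hr : ∀ᵐ p : ℝ × ℝ, 0 ≤ r p := by
    have := (volume_preserving_finTwoArrow ℝ).symm.quasiMeasurePreserving.ae hP.2.1
    filter_upwards [this] with p hp using hp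
  have key : ∀ f : ℝ × ℝ → ℝ, Measurable f →
      ∫⁻ ω, ∑ p ∈ (ω.window N).offDiag, ENNReal.ofReal (f p) ∂P
        = ∫⁻ p in Icc 0 (N : ℝ) ×ˢ Icc 0 (N : ℝ), ENNReal.ofReal (f p * r p) := by
    intro f hf
    rw [lintegral_sum_offDiag hP N hf.ennreal_ofReal]
    refine lintegral_congr_ae (ae_restrict_of_ae ?_)
    filter_upwards [hr] with p hp
    rw [ENNReal.ofReal_mul' hp]
  have hpos := key f hf
  have hneg := key (fun p => -f p) hf.neg
  have fpos : ∫⁻ p in Icc 0 (N : ℝ) ×ˢ Icc 0 (N : ℝ), ENNReal.ofReal (f p * r p) ≠ ⊤ :=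
    hi.lintegral_lt_top.ne
  have fneg : ∫⁻ p in Icc 0 (N : ℝ) ×ˢ Icc 0 (N : ℝ), ENNReal.ofReal (-f p * r p) ≠ ⊤ := by
    simpa using! hi.neg.lintegral_lt_top.ne
  have mpos := measurable_sum_offDiag N hf.ennreal_ofReal
  have mneg := measurable_sum_offDiag N (g := fun p => ENNReal.ofReal (-f p)) hf.neg.ennreal_ofReal
  have ipos := integrable_toReal_of_lintegral_ne_top mpos.aemeasurable (hpos ▸ fpos)
  have ineg := integrable_toReal_of_lintegral_ne_top mneg.aemeasurable (hneg ▸ fneg)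
  have e : ∀ ω : PointConfiguration, ∑ p ∈ (ω.window N).offDiag, f p
      = (∑ p ∈ (ω.window N).offDiag, ENNReal.ofReal (f p)).toReal
        - (∑ p ∈ (ω.window N).offDiag, ENNReal.ofReal (-f p)).toReal := by
    intro ω
    rw [ENNReal.toReal_sum fun _ _ => ENNReal.ofReal_ne_top,
      ENNReal.toReal_sum fun _ _ => ENNReal.ofReal_ne_top, ← Finset.sum_sub_distrib]
    refine Finset.sum_congr rfl fun p _ => ?_
    rw [ENNReal.toReal_ofReal', ENNReal.toReal_ofReal', max_zero_sub_max_neg_zero_eq_self]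
  simp only [e]
  refine ⟨ipos.sub ineg, ?_⟩
  have ne : ∀ s : Finset (ℝ × ℝ), ∀ h : ℝ × ℝ → ℝ, ∑ p ∈ s, ENNReal.ofReal (h p) < ⊤ :=
    fun s h => ENNReal.sum_lt_top.2 fun _ _ => ENNReal.ofReal_lt_top
  rw [integral_sub ipos ineg, integral_toReal mpos.aemeasurable (ae_of_all _ fun ω => ne _ f),
    integral_toReal mneg.aemeasurable (ae_of_all _ fun ω => ne _ fun p => -f p), hpos, hneg,
    integral_eq_lintegral_pos_part_sub_lintegral_neg_part hi]
  simp only [neg_mul]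

end PointConfiguration

/-! ### The limit of the expected energy -/

namespace IsClusterProfile

variable {T : ℝ → ℝ} {L : ℝ} {P : Measure PointConfiguration}

theorem energyLimitAssumptions (h : IsClusterProfile T L)
    (h1 : IsCorrelationFunction P 1 fun _ => 1)
    (h2 : IsCorrelationFunction P 2 fun x => 1 - T (x 0 - x 1)) :
    EnergyLimitAssumptions P T where
  rho_one := h1
  rho_two := h2
  bounded := by
    obtain ⟨C, hC⟩ := h.bounded
    exact ⟨C, by rintro _ ⟨v, rfl⟩; exact hC v⟩
  integral_eq_one := h.hasImproperIntegral
  exists_scale := h.exists_scale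
  log_integral := ⟨L, h.hasImproperIntegral_log⟩

theorem integral_renormalizedEnergy [IsProbabilityMeasure P] (h : IsClusterProfile T L)
    (h2 : IsCorrelationFunction P 2 fun x => 1 - T (x 0 - x 1)) {N : ℕ} (hN : 1 ≤ N) :
    Integrable (PointConfiguration.renormalizedEnergy N) P ∧
    ∫ ω, PointConfiguration.renormalizedEnergy N ω ∂P
      = Real.log N + 2 / N * ∫ y in (0 : ℝ)..N, logSinPrimitive T N y := by
  have hN0 : (0 : ℝ) < N := by exact_mod_cast hN
  obtain ⟨i1, e1⟩ := h.setIntegral_square hN0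
  obtain ⟨i2, e2⟩ := PointConfiguration.integral_sum_offDiag
    (r := fun p : ℝ × ℝ => 1 - T (p.1 - p.2)) h2 N
    (f := fun p : ℝ × ℝ => Real.log |2 * Real.sin (Real.pi * (p.1 - p.2) / N)|)
    (by fun_prop) i1
  have i3 := i2.const_mul (-(1 / (N : ℝ)))
  refine ⟨i3.add (integrable_const _), ?_⟩
  simp only [PointConfiguration.renormalizedEnergy]
  rw [integral_add i3 (integrable_const _), integral_const_mul, e2, e1]
  simp
  ring

theorem expectedEnergyTendsto [IsProbabilityMeasure P] (h : IsClusterProfile T L)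
    (h2 : IsCorrelationFunction P 2 fun x => 1 - T (x 0 - x 1)) :
    ExpectedEnergyTendsto P (L + Real.log (2 * Real.pi)) := by
  refine ⟨fun N hN => (h.integral_renormalizedEnergy h2 hN).1, ?_⟩
  refine h.tendsto_log_add_average.congr' ?_
  filter_upwards [eventually_ge_atTop 1] with N hN
  exact (h.integral_renormalizedEnergy h2 hN).2.symm

end IsClusterProfile

/-! ### The cluster functions of the sine processes -/

/-- Substitute `x = c v`: the logarithm splits as `log v = log x - log c`, and `∫_0^∞ τ = c/2` turns
the second term into `-log c` after doubling for evenness. -/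
lemma isClusterProfile_comp_mul_abs {τ : ℝ → ℝ} {c C Λ : ℝ} (hτ : Continuous τ) (hc : 0 < c)
    (hb : ∀ x, 0 ≤ x → |τ x| ≤ C)
    (ht : ∀ x, 0 < x → |(∫ u in (0 : ℝ)..x, τ u) - c / 2| ≤ C / x)
    (hl : Tendsto (fun X => ∫ x in (0 : ℝ)..X, τ x * Real.log x) atTop (𝓝 Λ)) :
    IsClusterProfile (fun v => τ (c * |v|)) (2 * Λ / c - Real.log c) := by
  have hint : ∀ v, 0 ≤ v → ∫ u in (0 : ℝ)..v, τ (c * |u|) = c⁻¹ * ∫ x in (0 : ℝ)..(c * v), τ x := by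
    intro v hv
    have h := intervalIntegral.integral_comp_mul_left (a := 0) (b := v) τ hc.ne'
    rw [mul_zero, smul_eq_mul] at h
    rw [← h]
    refine intervalIntegral.integral_congr fun u hu => ?_
    rw [uIcc_of_le hv] at hu
    simp only [abs_of_nonneg hu.1]
  refine ⟨by fun_prop, fun v => by simp only [abs_neg], ⟨C, fun v => hb _ (by positivity)⟩,
    ⟨c⁻¹ * (C / c), fun v hv => ?_⟩, ?_⟩
  · rw [hint v hv.le]
    have e : c⁻¹ * (∫ x in (0 : ℝ)..(c * v), τ x) - 1 / 2
        = c⁻¹ * ((∫ x in (0 : ℝ)..(c * v), τ x) - c / 2) := by field_simp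
    rw [e, abs_mul, abs_of_pos (inv_pos.2 hc)]
    calc _ ≤ c⁻¹ * (C / (c * v)) := by gcongr; exact ht _ (by positivity)
      _ = _ := by field_simp
  · have tint : Tendsto (fun X => ∫ x in (0 : ℝ)..X, τ x) atTop (𝓝 (c / 2)) := by
      rw [tendsto_iff_norm_sub_tendsto_zero]
      refine squeeze_zero' (Eventually.of_forall fun _ => norm_nonneg _) ?_
        (tendsto_const_nhds.div_atTop tendsto_id : Tendsto (fun v : ℝ => C / v) atTop (𝓝 0))
      filter_upwards [eventually_gt_atTop 0] with v hv using ht v hv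
    have key := (((hl.sub (tint.const_mul (Real.log c))).const_mul c⁻¹).comp
      (tendsto_id.const_mul_atTop hc))
    have e : c⁻¹ * (Λ - Real.log c * (c / 2)) = (2 * Λ / c - Real.log c) / 2 := by
      field_simp
    rw [e] at key
    refine key.congr' ?_
    filter_upwards [eventually_ge_atTop 0] with R hR
    have h := intervalIntegral.integral_comp_mul_left (a := 0) (b := R)
      (fun x => τ x * Real.log x - Real.log c * τ x) hc.ne'
    rw [mul_zero, smul_eq_mul, intervalIntegral.integral_sub
      (intervalIntegral.intervalIntegrable_log'.continuousOn_mul hτ.continuousOn)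
      ((hτ.intervalIntegrable _ _).const_mul _), intervalIntegral.integral_const_mul] at h
    simp only [Function.comp, id]
    rw [← h, intervalIntegral.integral_of_le hR, intervalIntegral.integral_of_le hR]
    refine setIntegral_congr_fun measurableSet_Ioc fun v hv => ?_
    simp only [abs_of_pos hv.1]
    rw [Real.log_mul hc.ne' hv.1.ne']
    ring

/-! ### The common profile for `β = 1` and `β = 4` -/

namespace Real

/-- The primitive of `sinc ^ 2 - sinc' * (sinIntegral - a)`. -/
lemma integral_sinc_sq_sub_deriv_mul (a x : ℝ) :
    ∫ u in (0 : ℝ)..x, (sinc u ^ 2 - deriv sinc u * (sinIntegral u - a))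
      = 2 * (∫ u in (0 : ℝ)..x, sinc u ^ 2) - sinc x * (sinIntegral x - a) - a := by
  have hd : ∀ u ∈ uIcc 0 x, HasDerivAt (fun u => sinc u * (sinIntegral u - a))
      (deriv sinc u * (sinIntegral u - a) + sinc u * sinc u) u := fun u _ =>
    (hasDerivAt_sinc u).mul ((hasDerivAt_sinIntegral u).sub_const a)
  have hc : Continuous fun u => deriv sinc u * (sinIntegral u - a) + sinc u * sinc u :=
    (continuous_deriv_sinc.mul (continuous_sinIntegral.sub continuous_const)).add
      (continuous_sinc.mul continuous_sinc)
  have h := intervalIntegral.integral_eq_sub_of_hasDerivAt hd (hc.intervalIntegrable _ _)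
  have hs : IntervalIntegrable (fun u => 2 * sinc u ^ 2) volume 0 x :=
    ((continuous_sinc.pow 2).intervalIntegrable _ _).const_mul 2
  have e : ∀ u, sinc u ^ 2 - deriv sinc u * (sinIntegral u - a)
      = 2 * sinc u ^ 2 - (deriv sinc u * (sinIntegral u - a) + sinc u * sinc u) := fun u => by ring
  simp only [e]
  rw [intervalIntegral.integral_sub hs (hc.intervalIntegrable _ _), h,
    intervalIntegral.integral_const_mul, sinIntegral_zero, sinc_zero]
  ring

lemma continuous_sinc_sq_sub_deriv_mul (a : ℝ) :
    Continuous fun u => sinc u ^ 2 - deriv sinc u * (sinIntegral u - a) :=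
  (continuous_sinc.pow 2).sub
    (continuous_deriv_sinc.mul (continuous_sinIntegral.sub continuous_const))

lemma exists_abs_sinc_sq_sub_deriv_mul_le (a : ℝ) :
    ∃ C, ∀ u, 0 ≤ u → |sinc u ^ 2 - deriv sinc u * (sinIntegral u - a)| ≤ C := by
  obtain ⟨D, hD⟩ := exists_abs_deriv_sinc_le
  refine ⟨1 + D * (6 + |a|), fun u hu => (abs_sub _ _).trans ?_⟩
  rw [abs_of_nonneg (sq_nonneg (sinc u)), abs_mul]
  have h1 : |sinIntegral u - a| ≤ 6 + |a| :=
    (abs_sub _ _).trans (by linarith [abs_sinIntegral_le_six hu])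
  exact add_le_add (sinc_sq_le_one u)
    (mul_le_mul (hD u) h1 (abs_nonneg _) ((abs_nonneg _).trans (hD u)))

lemma abs_integral_sinc_sq_sub_deriv_mul_le (a : ℝ) {x : ℝ} (hx : 0 < x) :
    |(∫ u in (0 : ℝ)..x, (sinc u ^ 2 - deriv sinc u * (sinIntegral u - a))) - (π - a)|
      ≤ (8 + |a|) / x := by
  rw [integral_sinc_sq_sub_deriv_mul]
  have e : 2 * (∫ u in (0 : ℝ)..x, sinc u ^ 2) - sinc x * (sinIntegral x - a) - a - (π - a)
      = 2 * ((∫ u in (0 : ℝ)..x, sinc u ^ 2) - π / 2) - sinc x * (sinIntegral x - a) := by ring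
  rw [e]
  refine (abs_sub _ _).trans ?_
  rw [abs_mul, abs_mul, abs_two]
  have h1 : |sinIntegral x - a| ≤ 6 + |a| :=
    (abs_sub _ _).trans (by linarith [abs_sinIntegral_le_six hx.le])
  have h2 := mul_le_mul (abs_sinc_le_inv hx) h1 (abs_nonneg _) (by positivity)
  have h3 := abs_integral_sinc_sq_sub_le hx
  have : (8 + |a|) / x = 2 * (1 / x) + 1 / x * (6 + |a|) := by ring
  rw [this]
  linarith

/-- The integrand is `2 sinc² - (sinc Si)' + a sinc'` times `log`, and each of the three limits is
known. -/
lemma tendsto_integral_sinc_sq_sub_deriv_mul_log (a : ℝ) :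
    Tendsto (fun X => ∫ x in (0 : ℝ)..X,
      (sinc x ^ 2 - deriv sinc x * (sinIntegral x - a)) * log x) atTop
      (𝓝 (π * (1 - eulerMascheroniConstant - log 2) + π / 2
        + a * (eulerMascheroniConstant - 1))) := by
  have key := ((tendsto_integral_sinc_sq_mul_log.const_mul 2).sub
    tendsto_integral_deriv_sinc_mul_sinIntegral_mul_log).add
    (tendsto_integral_deriv_sinc_mul_log.const_mul a)
  have e : 2 * (π / 2 * (1 - eulerMascheroniConstant - log 2)) - -(π / 2)
      + a * (eulerMascheroniConstant - 1) = π * (1 - eulerMascheroniConstant - log 2) + π / 2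
        + a * (eulerMascheroniConstant - 1) := by ring
  rw [e] at key
  refine key.congr fun X => ?_
  have i1 : IntervalIntegrable (fun x => 2 * (sinc x ^ 2 * log x)) volume 0 X :=
    (intervalIntegral.intervalIntegrable_log'.continuousOn_mul
      (continuous_sinc.pow 2).continuousOn).const_mul 2
  have i2 : IntervalIntegrable (fun x =>
      (deriv sinc x * sinIntegral x + sinc x * sinc x) * log x) volume 0 X :=
    intervalIntegral.intervalIntegrable_log'.continuousOn_mul
      continuous_deriv_sinc_mul_sinIntegral.continuousOn
  have i3 : IntervalIntegrable (fun x => a * (deriv sinc x * log x)) volume 0 X :=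
    (intervalIntegral.intervalIntegrable_log'.continuousOn_mul
      continuous_deriv_sinc.continuousOn).const_mul a
  rw [← intervalIntegral.integral_const_mul, ← intervalIntegral.integral_const_mul,
    ← intervalIntegral.integral_sub i1 i2, ← intervalIntegral.integral_add (i1.sub i2) i3]
  refine intervalIntegral.integral_congr fun x _ => ?_
  ring

end Real

/-! ### Quaternion determinants of size one and two -/

lemma quaternionDet_one (q : Fin 1 → Fin 1 → Matrix (Fin 2) (Fin 2) ℝ) :
    quaternionDet q = 1 / 2 * (q 0 0).trace := by
  have hd : (default : Equiv.Perm (Fin 1)) = 1 := Subsingleton.elim _ _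
  have hf : (Finset.univ.filter fun i : Fin 1 =>
      ∀ j, (1 : Equiv.Perm (Fin 1)).SameCycle i j → i ≤ j) = {0} := by
    ext i; simp [Subsingleton.elim i 0]
  rw [quaternionDet, Fintype.sum_unique, hd, hf]
  simp

lemma quaternionDet_two (q : Fin 2 → Fin 2 → Matrix (Fin 2) (Fin 2) ℝ) :
    quaternionDet q = 1 / 2 * (q 0 0).trace * (1 / 2 * (q 1 1).trace)
      - 1 / 2 * (q 0 1 * q 1 0).trace := by
  have hu : (Finset.univ : Finset (Equiv.Perm (Fin 2))) = {1, Equiv.swap 0 1} := by decide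
  have hp : ∀ i, Function.minimalPeriod (⇑(1 : Equiv.Perm (Fin 2))) i = 1 := fun i =>
    Function.minimalPeriod_eq_one_iff_isFixedPt.2 rfl
  have hs : Function.minimalPeriod (⇑(Equiv.swap (0 : Fin 2) 1)) 0 = 2 :=
    Function.minimalPeriod_eq_prime (p := 2) (by decide) (by decide)
  have f1 : (Finset.univ.filter fun i : Fin 2 =>
      ∀ j, (1 : Equiv.Perm (Fin 2)).SameCycle i j → i ≤ j) = {0, 1} := by
    ext i
    simp only [Equiv.Perm.sameCycle_one]
    fin_cases i <;> simp
  have f2 : (Finset.univ.filter fun i : Fin 2 =>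
      ∀ j, (Equiv.swap (0 : Fin 2) 1).SameCycle i j → i ≤ j) = {0} := by
    ext i
    fin_cases i
    · simp
    · have : (Equiv.swap (0 : Fin 2) 1).SameCycle 1 0 := ⟨1, by simp⟩
      simp only [Finset.mem_filter, Finset.mem_univ, true_and, Finset.mem_singleton]
      constructor
      · intro h
        exact absurd (h 0 this) (by decide)
      · intro h
        exact absurd h (by decide)
  rw [quaternionDet, hu, Finset.sum_pair (by decide), f1, f2, Finset.prod_pair (by decide),
    Finset.prod_singleton, hp, hp, hs]
  simp [List.range_succ, pow_two]
  ring

/-! ### The correlation functions -/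

lemma deriv_sinc_mul_sub (c x y : ℝ) :
    deriv (fun t => Real.sinc (c * (t - y))) x = c * deriv Real.sinc (c * (x - y)) := by
  have h : HasDerivAt (fun t : ℝ => c * (t - y)) c x := by
    simpa using ((hasDerivAt_id x).sub_const y).const_mul c
  have h2 : HasDerivAt (fun t => Real.sinc (c * (t - y))) (deriv Real.sinc (c * (x - y)) * c) x :=
    (Real.hasDerivAt_sinc _).comp x h
  rw [h2.deriv, mul_comm]

lemma sineCorrelationTwo_two (x : Fin 2 → ℝ) :
    sineCorrelationTwo 2 x = 1 - Real.sinc (Real.pi * |x 0 - x 1|) ^ 2 := by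
  have e : Real.sinc (Real.pi * |x 0 - x 1|) = Real.sinc (Real.pi * (x 0 - x 1)) := by
    rcases abs_cases (x 0 - x 1) with ⟨h, _⟩ | ⟨h, _⟩ <;> rw [h]
    rw [mul_neg, Real.sinc_neg]
  have e2 : Real.sinc (Real.pi * (x 1 - x 0)) = Real.sinc (Real.pi * (x 0 - x 1)) := by
    rw [← neg_sub, mul_neg, Real.sinc_neg]
  rw [sineCorrelationTwo, Matrix.det_fin_two, e]
  simp only [Matrix.of_apply, sineKernelTwo, sub_self, mul_zero, Real.sinc_zero, e2]
  ring

/-- The odd kernel entries change sign when the points are exchanged, so `T` is even and `v` may be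
replaced by `|v|`, with the sign term becoming `π/2`. At `v = 0`, where the sign jumps, `sinc' 0 =
0` makes both expressions agree. -/
lemma sineCorrelationOne_two (x : Fin 2 → ℝ) :
    sineCorrelationOne 2 x = 1 - (Real.sinc (Real.pi * |x 0 - x 1|) ^ 2
      - deriv Real.sinc (Real.pi * |x 0 - x 1|)
        * (Real.sinIntegral (Real.pi * |x 0 - x 1|) - Real.pi / 2)) := by
  have hpi := Real.pi_ne_zero
  have d0 : deriv Real.sinc 0 = 0 := by
    have := Real.deriv_sinc_neg 0
    rw [neg_zero] at this
    linarith
  have e2 : x 1 - x 0 = -(x 0 - x 1) := by ring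
  rw [sineCorrelationOne, quaternionDet_two]
  simp only [sineKernelOne, deriv_sinc_mul_sub, Real.integral_sin_div_eq_sinIntegral,
    Matrix.trace_fin_two, Matrix.mul_apply, Fin.sum_univ_two, Matrix.of_apply, Matrix.cons_val',
    Matrix.cons_val_zero, Matrix.cons_val_one, Matrix.cons_val_fin_one, sub_self, mul_zero,
    Real.sinc_zero]
  rw [e2]
  generalize x 0 - x 1 = v
  simp only [mul_neg, Real.sinc_neg, Real.deriv_sinc_neg, Real.sinIntegral_neg, Real.sign_neg]
  rcases lt_trichotomy v 0 with h | h | h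
  · rw [abs_of_neg h, Real.sign_of_neg h, mul_neg Real.pi v, Real.sinc_neg, Real.deriv_sinc_neg,
      Real.sinIntegral_neg]
    field_simp
    ring
  · subst h
    simp [d0]
    norm_num
  · rw [abs_of_pos h, Real.sign_of_pos h]
    field_simp
    ring

lemma sineCorrelationFour_two (x : Fin 2 → ℝ) :
    sineCorrelationFour 2 x = 1 - (Real.sinc (2 * Real.pi * |x 0 - x 1|) ^ 2
      - deriv Real.sinc (2 * Real.pi * |x 0 - x 1|)
        * (Real.sinIntegral (2 * Real.pi * |x 0 - x 1|) - 0)) := by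
  have hpi := Real.pi_ne_zero
  have e2 : x 1 - x 0 = -(x 0 - x 1) := by ring
  rw [sineCorrelationFour, quaternionDet_two]
  simp only [sineKernelFour, deriv_sinc_mul_sub, Real.integral_sin_div_eq_sinIntegral,
    Matrix.trace_fin_two, Matrix.mul_apply, Fin.sum_univ_two, Matrix.of_apply, Matrix.cons_val',
    Matrix.cons_val_zero, Matrix.cons_val_one, Matrix.cons_val_fin_one, sub_self, mul_zero,
    Real.sinc_zero]
  rw [e2]
  generalize x 0 - x 1 = v
  simp only [mul_neg, Real.sinc_neg, Real.deriv_sinc_neg, Real.sinIntegral_neg]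
  rcases abs_cases v with ⟨h, _⟩ | ⟨h, _⟩
  · rw [h]
    field_simp
    ring
  · rw [h, mul_neg, Real.sinc_neg, Real.deriv_sinc_neg, Real.sinIntegral_neg]
    field_simp
    ring

lemma sineCorrelationOne_one (x : Fin 1 → ℝ) : sineCorrelationOne 1 x = 1 := by
  rw [sineCorrelationOne, quaternionDet_one]
  simp [sineKernelOne, Matrix.trace_fin_two]
  norm_num

lemma sineCorrelationTwo_one (x : Fin 1 → ℝ) : sineCorrelationTwo 1 x = 1 := by
  simp [sineCorrelationTwo, sineKernelTwo]

lemma sineCorrelationFour_one (x : Fin 1 → ℝ) : sineCorrelationFour 1 x = 1 := by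
  rw [sineCorrelationFour, quaternionDet_one]
  simp [sineKernelFour, Matrix.trace_fin_two]
  norm_num

/-- The conclusion for a process whose two-point function comes from a cluster profile. -/
lemma energy_of_hasCorrelationFunctions {P : Measure PointConfiguration}
    {ρ : ∀ n : ℕ, (Fin n → ℝ) → ℝ} (hP : HasCorrelationFunctions P ρ) (h1 : ∀ x, ρ 1 x = 1)
    {T : ℝ → ℝ} {L : ℝ} (hT : IsClusterProfile T L)
    (h2 : ∀ x, ρ 2 x = 1 - T (x 0 - x 1)) :
    EnergyLimitAssumptions P (clusterFunction ρ) ∧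
      ExpectedEnergyTendsto P (L + Real.log (2 * Real.pi)) := by
  obtain ⟨hprob, hcor⟩ := hP
  have e : clusterFunction ρ = T := by
    funext v
    rw [clusterFunction, h2]
    simp
  have c1 := hcor 1 le_rfl
  rw [funext h1] at c1
  have c2 := hcor 2 one_le_two
  rw [funext h2] at c2
  rw [e]
  exact ⟨hT.energyLimitAssumptions c1 c2, hT.expectedEnergyTendsto c2⟩

theorem proposition3p2 :
    (∀ P : Measure PointConfiguration, IsSineProcessOne P →
      EnergyLimitAssumptions P (clusterFunction sineCorrelationOne) ∧
      ExpectedEnergyTendsto P (2 - Real.eulerMascheroniConstant - Real.log 2)) ∧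
    (∀ P : Measure PointConfiguration, IsSineProcessTwo P →
      EnergyLimitAssumptions P (clusterFunction sineCorrelationTwo) ∧
      ExpectedEnergyTendsto P (1 - Real.eulerMascheroniConstant)) ∧
    (∀ P : Measure PointConfiguration, IsSineProcessFour P →
      EnergyLimitAssumptions P (clusterFunction sineCorrelationFour) ∧
      ExpectedEnergyTendsto P (3 / 2 - Real.log 2 - Real.eulerMascheroniConstant)) := by
  have hpi := Real.pi_ne_zero
  have hlog : Real.log (2 * Real.pi) = Real.log 2 + Real.log Real.pi :=
    Real.log_mul two_ne_zero hpi
  refine ⟨fun P hP => ?_, fun P hP => ?_, fun P hP => ?_⟩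
  -- The profile has half-line integral `π - a`, which must be `c/2`: here `a = π/2` with `c = π`.
  · obtain ⟨C, hC⟩ := Real.exists_abs_sinc_sq_sub_deriv_mul_le (Real.pi / 2)
    have hτ := isClusterProfile_comp_mul_abs (C := max C (8 + |Real.pi / 2|))
      (Real.continuous_sinc_sq_sub_deriv_mul (Real.pi / 2)) Real.pi_pos
      (fun x hx => (hC x hx).trans (le_max_left _ _))
      (fun x hx => by
        have := Real.abs_integral_sinc_sq_sub_deriv_mul_le (Real.pi / 2) hx
        rw [sub_half] at this
        exact this.trans (by gcongr; exact le_max_right _ _))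
      (Real.tendsto_integral_sinc_sq_sub_deriv_mul_log (Real.pi / 2))
    have := energy_of_hasCorrelationFunctions hP sineCorrelationOne_one hτ sineCorrelationOne_two
    convert this using 2
    rw [hlog]
    field_simp
    ring
  · have hτ := isClusterProfile_comp_mul_abs (C := 1) (Real.continuous_sinc.pow 2) Real.pi_pos
      (fun x _ => by
        rw [Pi.pow_apply, abs_of_nonneg (sq_nonneg _)]; exact Real.sinc_sq_le_one x)
      (fun x hx => Real.abs_integral_sinc_sq_sub_le hx) Real.tendsto_integral_sinc_sq_mul_log
    have := energy_of_hasCorrelationFunctions hP sineCorrelationTwo_one hτ sineCorrelationTwo_two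
    convert this using 2
    rw [hlog]
    field_simp
    ring
  -- Here `a = 0`, so `π - a = c/2` with `c = 2π`; the `-log c` in `L` then cancels `log 2π`
  -- entirely.
  · obtain ⟨C, hC⟩ := Real.exists_abs_sinc_sq_sub_deriv_mul_le 0
    have hτ := isClusterProfile_comp_mul_abs (c := 2 * Real.pi) (C := max C (8 + |0|))
      (Real.continuous_sinc_sq_sub_deriv_mul 0) (by positivity)
      (fun x hx => (hC x hx).trans (le_max_left _ _))
      (fun x hx => by
        have := Real.abs_integral_sinc_sq_sub_deriv_mul_le 0 hx
        rw [sub_zero] at this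
        rw [mul_div_cancel_left₀ _ two_ne_zero]
        exact this.trans (by gcongr; exact le_max_right _ _))
      (Real.tendsto_integral_sinc_sq_sub_deriv_mul_log 0)
    have := energy_of_hasCorrelationFunctions hP sineCorrelationFour_one hτ sineCorrelationFour_two
    convert this using 2
    rw [hlog]
    field_simp
    ring

end
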